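/- **Setting.** Let $\mathbb T_m$ denote the set of isomorphism classes of free (unrooted) trees with $m\ge 1$ vertices and let $\mathcal M$ be the $\mathbb Q$-vector space with basis $\bigcup_m\mathbb T_m$, graded by the number of vertices, $\mathcal M=\bigoplus_{m\ge1}\mathcal M_m$. Let $\mathcal H$ be the $\mathbb Q$-vector space spanned by isomorphism classes of finite rooted trees (the Grossman–Larson algebra); it acts bilinearly on $\mathcal M$ by $$S\cdot T=\sum_{(v_1,\dots,v_k)\in V(T)^k}(S_1,\dots,S_k)\multimap_{(v_1,\dots,v_k)}T ,$$ where $S_1,\dots,S_k$ are the branches of $S$ at its root (rooted at the children of the root) and $(S_1,\dots,S_k)\multimap_{(v_1,\dots,v_k)}T$ is the free tree obtained from the disjoint union of $T,S_1,\dots,S_k$ by joining the root of $S_i$ to $v_i$ by a new edge for each $i$. For a positive integer $r$, a *naked $r$-chain* in a tree is a path through distinct vertices $v_1,\dots,v_r$ such that $v_2,\dots,v_{r-1}$ have degree $2$ and $v_1,v_r$ have degree $1$ or $2$. Let $\mathcal C(r)\subseteq\mathcal M$ be the smallest $\mathbb Q$-subspace that contains all trees with a naked $r$-chain and is stable under the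 action of $\mathcal H$, let $\mathcal V(e)$ be the $\mathbb Q$-span of all trees having a vertex of degree $\ge e+1$, and let $\overline{\mathcal M}(r,e)=\mathcal M/(\mathcal C(r)+\mathcal V(e))$. Let $\overline{\mathcal M}(r,e)_m$ be the image of $\mathcal M_m$, and $\overline\nu_m$ the image of $\nu_m=\sum_{T\in\mathbb T_m}\frac1{|\mathrm{Aut}\,T|}\,T$. Let $K$ be a commutative $\mathbb Q$-algebra, and let $D_i=\partial/\partial X_i$ on $K[X_1,\dots,X_n]$. For $H=(H_1,\dots,H_n)$ with $H_i\in K[X_1,\dots,X_n]$ put $JH=(D_iH_j)$ and, for $m\ge1$ and $1\le i\le n$, $$N^{(m)}_i=\sum_{S}\frac1{|\mathrm{Aut}\,S|}\sum_{\substack{\ell:V(S)\to\{1,\dots,n\}\\ \ell(\mathrm{rt}_S)=i}}\ \prod_{v\in V(S)}\Big(\prod_{w\in v^+}D_{\ell(w)}\Big)H_{\ell(v)} ,$$ where $S$ runs over the isomorphism classes of rooted trees with $m$ vertices, automorphisms of $S$ fix the root, and $v^+$ is the set of children of $v$. Write $N^{(m)}=(N^{(m)}_1,\dots,N^{(m)}_n)$.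 For positive integers $r,M$ let $(\ast)_{r,M}$ be the assertion: for every commutative $\mathbb Q$-algebra $K$, every $n$ and every polynomial map $F=X-H$ over $K$ in $n$ variables with all $H_i$ homogeneous of degree $3$, $JH$ symmetric and $(JH)^r=0$, the map $F$ is invertible as a polynomial map with two-sided inverse $$F^{-1}=X+N^{(1)}+N^{(2)}+\cdots+N^{(M)} ,$$ and in particular all components of $F^{-1}$ have degree $\le 2M+1$. **Theorem.** Let $r$ be a positive integer. 1. If $M$ is a positive integer with $\overline\nu_m=0$ in $\overline{\mathcal M}(r,4)$ for $M+1\le m\le 2M$, then $(\ast)_{r,M}$ holds. 2. If $M$ is a positive integer with $\overline{\mathcal M}(r,4)_m=0$ for $M+1\le m\le 2M$, then $(\ast)_{r,M}$ holds. 3. If $\overline{\mathcal M}(r,4)$ is finite-dimensional over $\mathbb Q$, then there is a positive integer $M$ with $\overline{\mathcal M}(r,4)_m=0$ for all $m\ge M+1$ such that $(\ast)_{r,M}$ holds. -/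

import Mathlib

universe u

namespace TreeModule

/-! ### Free trees and rooted trees up to isomorphism -/

/-- Two trees on the vertex set `Fin m` are equivalent when they are isomorphic as graphs. -/
instance freeTreeSetoid (m : ℕ) : Setoid {G : SimpleGraph (Fin m) // G.IsTree} where
  r G G' := Nonempty (G.1 ≃g G'.1)
  iseqv := ⟨fun _ => ⟨SimpleGraph.Iso.refl⟩, fun ⟨f⟩ => ⟨f.symm⟩, fun ⟨f⟩ ⟨g⟩ => ⟨f.trans g⟩⟩

/-- The set `𝕋_m` of isomorphism classes of free (unrooted) trees with `m` vertices. -/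
def FreeTree (m : ℕ) : Type := Quotient (freeTreeSetoid m)

/-- Two rooted trees on the vertex set `Fin m` are equivalent when there is a graph isomorphism
which respects the roots. -/
instance rootedTreeSetoid (m : ℕ) :
    Setoid {p : SimpleGraph (Fin m) × Fin m // p.1.IsTree} where
  r S S' := ∃ f : S.1.1 ≃g S'.1.1, f S.1.2 = S'.1.2
  iseqv := by
    refine ⟨fun _ => ⟨SimpleGraph.Iso.refl, rfl⟩, ?_, ?_⟩
    · rintro S S' ⟨f, hf⟩
      exact ⟨f.symm, by rw [← hf]; exact f.symm_apply_apply _⟩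
    · rintro S S' S'' ⟨f, hf⟩ ⟨g, hg⟩
      exact ⟨f.trans g, by rw [← hg, ← hf]; rfl⟩

/-- The set of isomorphism classes of rooted trees with `m` vertices. -/
def RootedTree (m : ℕ) : Type := Quotient (rootedTreeSetoid m)

noncomputable instance (m : ℕ) : Fintype (FreeTree m) :=
  haveI : Finite (FreeTree m) := inferInstanceAs (Finite (Quotient (freeTreeSetoid m)))
  Fintype.ofFinite _

noncomputable instance (m : ℕ) : Fintype (RootedTree m) :=
  haveI : Finite (RootedTree m) := inferInstanceAs (Finite (Quotient (rootedTreeSetoid m)))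
  Fintype.ofFinite _

/-- A representative of an isomorphism class of free trees.  Everything below that is computed
from representatives is invariant under isomorphism. -/
noncomputable def FreeTree.graph {m : ℕ} (T : FreeTree m) : SimpleGraph (Fin m) :=
  (Quotient.out T).1

theorem FreeTree.isTree {m : ℕ} (T : FreeTree m) : T.graph.IsTree := (Quotient.out T).2

/-- A representative of an isomorphism class of rooted trees ... -/
noncomputable def RootedTree.graph {m : ℕ} (S : RootedTree m) : SimpleGraph (Fin m) :=
  (Quotient.out S).1.1

/-- ... and its root. -/
noncomputable def RootedTree.root {m : ℕ} (S : RootedTree m) : Fin m :=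
  (Quotient.out S).1.2

theorem RootedTree.isTree {m : ℕ} (S : RootedTree m) : S.graph.IsTree := (Quotient.out S).2

/-- The order of the automorphism group of a free tree. -/
noncomputable def FreeTree.autCard {m : ℕ} (T : FreeTree m) : ℕ := Nat.card (T.graph ≃g T.graph)

/-- The order of the automorphism group of a rooted tree (automorphisms fix the root). -/
noncomputable def RootedTree.autCard {m : ℕ} (S : RootedTree m) : ℕ :=
  Nat.card {f : S.graph ≃g S.graph // f S.root = S.root}

/-- The isomorphism class of a tree on an arbitrary finite vertex set. -/
noncomputable def FreeTree.ofGraph {V : Type} [Fintype V] (G : SimpleGraph V) (hG : G.IsTree) :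
    Σ m, FreeTree m :=
  ⟨Fintype.card V, Quotient.mk (freeTreeSetoid _)
    ⟨G.map (Fintype.equivFin V).toEmbedding,
      (SimpleGraph.Iso.isTree_iff (SimpleGraph.Iso.map (Fintype.equivFin V) G)).1 hG⟩⟩

/-! ### The Grossman–Larson action -/

/-- Let `S` be a graph with root `ρ` and `T` another graph.  Delete `ρ` from `S` together with its
edges, and join each former child `c` of `ρ` by a new edge to the vertex `f c` of `T`.  For a
rooted tree `S` with branches `S₁, …, S_r` at the root this is
`(S₁, …, S_r) ⊸_{(v₁, …, v_r)} T`, where `v_i` is the value of `f` at the root of `S_i`. -/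
def graft {V W : Type} (S : SimpleGraph V) (ρ : V) (T : SimpleGraph W)
    (f : {c : V // S.Adj ρ c} → W) : SimpleGraph ({u : V // u ≠ ρ} ⊕ W) where
  Adj
    | .inl u, .inl v => S.Adj u.1 v.1
    | .inr x, .inr y => T.Adj x y
    | .inl u, .inr y => ∃ h : S.Adj ρ u.1, f ⟨u.1, h⟩ = y
    | .inr x, .inl v => ∃ h : S.Adj ρ v.1, f ⟨v.1, h⟩ = x
  symm := ⟨by
    rintro (u | x) (v | y) h
    · exact S.adj_symm h
    · exact h
    · exact h
    · exact T.adj_symm h⟩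
  loopless := ⟨by
    rintro (u | x) h
    · exact S.loopless.irrefl _ h
    · exact T.loopless.irrefl _ h⟩

section

variable {V W : Type} {S : SimpleGraph V} {ρ : V} {T : SimpleGraph W}
  {f : {c : V // S.Adj ρ c} → W}

@[simp] theorem graft_adj_inl_inl {u v : {u : V // u ≠ ρ}} :
    (graft S ρ T f).Adj (.inl u) (.inl v) ↔ S.Adj u.1 v.1 := Iff.rfl

@[simp] theorem graft_adj_inr_inr {x y : W} :
    (graft S ρ T f).Adj (.inr x) (.inr y) ↔ T.Adj x y := Iff.rfl

@[simp] theorem graft_adj_inl_inr {u : {u : V // u ≠ ρ}} {y : W} :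
    (graft S ρ T f).Adj (.inl u) (.inr y) ↔ ∃ h : S.Adj ρ u.1, f ⟨u.1, h⟩ = y := Iff.rfl

@[simp] theorem graft_adj_inr_inl {x : W} {v : {u : V // u ≠ ρ}} :
    (graft S ρ T f).Adj (.inr x) (.inl v) ↔ ∃ h : S.Adj ρ v.1, f ⟨v.1, h⟩ = x := Iff.rfl

end

theorem graft_connected {V W : Type} {S : SimpleGraph V} {ρ : V} {T : SimpleGraph W}
    (hS : S.Connected) (hT : T.Connected) (f : {c : V // S.Adj ρ c} → W) :
    (graft S ρ T f).Connected := by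
  have hinr : ∀ x y : W, (graft S ρ T f).Reachable (.inr x) (.inr y) := by
    intro x y
    let φ : T →g graft S ρ T f := ⟨Sum.inr, fun {a b} h => h⟩
    exact (hT.preconnected x y).map φ
  have key : ∀ (u r : V), S.Walk u r → r = ρ → ∀ hu : u ≠ ρ,
      ∃ x, (graft S ρ T f).Reachable (.inl ⟨u, hu⟩) (.inr x) := by
    intro u r p
    induction p with
    | nil => intro h hu; exact absurd h hu
    | @cons a b c h p ih =>
      intro hr hu
      by_cases hb : b = ρ
      · subst hb
        refine ⟨f ⟨a, h.symm⟩, SimpleGraph.Adj.reachable ?_⟩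
        exact ⟨h.symm, rfl⟩
      · obtain ⟨x, hx⟩ := ih hr hb
        refine ⟨x, SimpleGraph.Reachable.trans (SimpleGraph.Adj.reachable ?_) hx⟩
        exact h
  obtain ⟨w⟩ := hT.nonempty
  have hall : ∀ a, (graft S ρ T f).Reachable a (.inr w) := by
    rintro (⟨u, hu⟩ | x)
    · obtain ⟨x, hx⟩ := key u ρ (hS.preconnected u ρ).some rfl hu
      exact hx.trans (hinr x w)
    · exact hinr x w
  have : Nonempty ({u : V // u ≠ ρ} ⊕ W) := ⟨.inr w⟩
  exact ⟨fun a b => (hall a).trans (hall b).symm⟩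

open Classical in
theorem graft_isTree {V W : Type} [Finite V] [Finite W] {S : SimpleGraph V} {ρ : V}
    {T : SimpleGraph W} (hS : S.IsTree) (hT : T.IsTree) (f : {c : V // S.Adj ρ c} → W) :
    (graft S ρ T f).IsTree := by
  have := Fintype.ofFinite V
  have := Fintype.ofFinite W
  have hconn := graft_connected (ρ := ρ) hS.connected hT.connected f
  rw [SimpleGraph.isTree_iff_connected_and_card]
  refine ⟨hconn, le_antisymm ?_ hconn.card_vert_le_card_edgeSet_add_one⟩
  set p : {u : V // u ≠ ρ} ⊕ W → V := Sum.elim (fun u => u.1) (fun _ => ρ) with hp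
  rw [Nat.card_eq_fintype_card, Nat.card_eq_fintype_card, ← SimpleGraph.edgeFinset_card,
    ← Finset.card_filter_add_card_filter_not (s := (graft S ρ T f).edgeFinset)
      (fun e => (Sym2.map p e).IsDiag)]
  have h1 : ((graft S ρ T f).edgeFinset.filter (fun e => (Sym2.map p e).IsDiag)).card
      ≤ T.edgeFinset.card := by
    refine (Finset.card_le_card (t := T.edgeFinset.image (Sym2.map Sum.inr)) ?_).trans
      Finset.card_image_le
    intro e
    induction e using Sym2.ind with
    | _ a b =>
      rcases a with a | a <;> rcases b with b | b <;> simp [hp]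
      · intro h h'; exact absurd h (by rw [h']; exact S.loopless.irrefl _)
      · intro h _ h'; exact absurd h' a.2
      · intro h _ h'; exact absurd h'.symm b.2
      · intro h; exact ⟨s(a, b), by simpa using h, by simp⟩
  have h2 : ((graft S ρ T f).edgeFinset.filter (fun e => ¬ (Sym2.map p e).IsDiag)).card
      ≤ S.edgeFinset.card := by
    refine Finset.card_le_card_of_injOn (Sym2.map p) ?_ ?_
    · intro e
      induction e using Sym2.ind with
      | _ a b =>
        rcases a with a | a <;> rcases b with b | b <;> simp [hp]
        · intro h _; exact h
        · intro h _ _; exact h.symm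
        · intro h _ _; exact h
    · intro e he e' he'
      induction e using Sym2.ind with
      | _ a b =>
      induction e' using Sym2.ind with
      | _ c d =>
        rcases a with ⟨a, ha⟩ | a <;> rcases b with ⟨b, hb⟩ | b <;>
          rcases c with ⟨c, hc⟩ | c <;> rcases d with ⟨d, hd⟩ | d <;>
          simp [hp] at he he' ⊢ <;> grind
  have h3 := hS.card_edgeFinset
  have h4 := hT.card_edgeFinset
  have h5 : Fintype.card ({u : V // u ≠ ρ} ⊕ W) = (Fintype.card V - 1) + Fintype.card W := by
    rw [Fintype.card_sum, Fintype.card_subtype_compl, Fintype.card_subtype_eq]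
  rw [h5]
  omega

/-- The rational vector space `𝓗` spanned by all rooted trees (underlying space of the
Grossman–Larson algebra). -/
abbrev RootedMod : Type := (Σ m, RootedTree m) →₀ ℚ

/-- The tree module `𝓜`: the rational vector space spanned by all free trees. -/
abbrev TreeMod : Type := (Σ m, FreeTree m) →₀ ℚ

/-- The free tree `T`, regarded as an element of `𝓜`. -/
noncomputable def tree {m : ℕ} (T : FreeTree m) : TreeMod := Finsupp.single ⟨m, T⟩ 1

open Classical in
/-- The action of `𝓗` on `𝓜`, bilinear, with
`S · T = ∑_{(v₁, …, v_r) ∈ V(T)^r} (S₁, …, S_r) ⊸_{(v₁, …, v_r)} T`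
for a rooted tree `S` with branches `S₁, …, S_r` at its root and a free tree `T`. -/
noncomputable def act : RootedMod →ₗ[ℚ] TreeMod →ₗ[ℚ] TreeMod :=
  Finsupp.linearCombination ℚ fun S : Σ k, RootedTree k =>
    Finsupp.linearCombination ℚ fun T : Σ m, FreeTree m =>
      ∑ f : {c : Fin S.1 // S.2.graph.Adj S.2.root c} → Fin T.1,
        Finsupp.single
          (FreeTree.ofGraph (graft S.2.graph S.2.root T.2.graph f)
            (graft_isTree S.2.isTree T.2.isTree f)) (1 : ℚ)

/-- The sub-`𝓗`-module of `𝓜` generated by a set: the smallest rational subspace which contains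
the set and is stable under the action of `𝓗`. -/
noncomputable def hSpan (A : Set TreeMod) : Submodule ℚ TreeMod :=
  sInf {W | A ⊆ W ∧ ∀ (h : RootedMod), ∀ x ∈ W, act h x ∈ W}

/-! ### The tree quotient modules -/

open Classical in
/-- `G` contains a naked `r`-chain: distinct vertices `v₁, …, v_r`, consecutive ones adjacent,
with `v₂, …, v_{r-1}` of degree `2` and `v₁, v_r` of degree `1` or `2`.  (In a tree such a path
is automatically a geodesic.) -/
def HasNakedChain {V : Type} [Fintype V] (G : SimpleGraph V) (r : ℕ) : Prop :=
  ∃ v : Fin r → V, Function.Injective v ∧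
    (∀ i j : Fin r, (i : ℕ) + 1 = j → G.Adj (v i) (v j)) ∧
    ∀ i : Fin r, G.degree (v i) = 2 ∨
      (((i : ℕ) = 0 ∨ (i : ℕ) + 1 = r) ∧ G.degree (v i) = 1)

/-- `𝓒(r)`: the sub-`𝓗`-module generated by all trees containing a naked `r`-chain. -/
noncomputable def chainSub (r : ℕ) : Submodule ℚ TreeMod :=
  hSpan {x | ∃ (m : ℕ) (T : FreeTree m), HasNakedChain T.graph r ∧ x = tree T}

open Classical in
/-- `𝓥(e)`: the subspace spanned by all trees with a vertex of degree at least `e + 1`. -/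
noncomputable def degreeSub (e : ℕ) : Submodule ℚ TreeMod :=
  Submodule.span ℚ
    {x | ∃ (m : ℕ) (T : FreeTree m), (∃ v, e + 1 ≤ T.graph.degree v) ∧ x = tree T}

/-- `𝓝(r, e) = 𝓒(r) + 𝓥(e)`. -/
noncomputable def relSub (r e : ℕ) : Submodule ℚ TreeMod := chainSub r ⊔ degreeSub e

/-- The tree quotient module `𝓜̄(r, e) = 𝓜 / 𝓝(r, e)`. -/
abbrev TreeQuot (r e : ℕ) : Type := TreeMod ⧸ relSub r e

/-- The graded piece `𝓜_m`, spanned by the trees with `m` vertices. -/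
noncomputable def gradedPiece (m : ℕ) : Submodule ℚ TreeMod :=
  Submodule.span ℚ (Set.range fun T : FreeTree m => tree T)

/-- The graded piece `𝓜̄(r, e)_m`, the image of `𝓜_m`. -/
noncomputable def quotPiece (r e m : ℕ) : Submodule ℚ (TreeQuot r e) :=
  (gradedPiece m).map (relSub r e).mkQ

/-- `ν_m = ∑_{T ∈ 𝕋_m} T / |Aut T|`. -/
noncomputable def nu (m : ℕ) : TreeMod := ∑ T : FreeTree m, (1 / (T.autCard : ℚ)) • tree T

/-- The image `ν̄_m` of `ν_m` in `𝓜̄(r, e)`. -/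
noncomputable def nuBar (r e m : ℕ) : TreeQuot r e := (relSub r e).mkQ (nu m)

/-! ### Polynomial maps -/

/-- Polynomial maps in `n` variables over `K`. -/
abbrev PolyMap (n : ℕ) (K : Type*) [CommRing K] := Fin n → MvPolynomial (Fin n) K

section

variable {n : ℕ} {K : Type*} [CommRing K]

/-- The Jacobian matrix `(D_i H_j)`. -/
noncomputable def jacobian (H : PolyMap n K) : Matrix (Fin n) (Fin n) (MvPolynomial (Fin n) K) :=
  Matrix.of fun i j => MvPolynomial.pderiv i (H j)

/-- `F = X - H` is of symmetric homogeneous type: `H` is homogeneous of degree `d ≥ 2` and `JH` is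
symmetric. -/
def IsSymmHomogType (d : ℕ) (F H : PolyMap n K) : Prop :=
  2 ≤ d ∧ (∀ i, F i = MvPolynomial.X i - H i) ∧ (∀ i, (H i).IsHomogeneous d) ∧ (jacobian H).IsSymm

/-- `G` is the two-sided compositional inverse of `F`: `F ∘ G = G ∘ F = X`. -/
def IsInverse (F G : PolyMap n K) : Prop :=
  (∀ i, MvPolynomial.bind₁ G (F i) = MvPolynomial.X i) ∧
    ∀ i, MvPolynomial.bind₁ F (G i) = MvPolynomial.X i

theorem pderiv_comm (i j : Fin n) (p : MvPolynomial (Fin n) K) :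
    MvPolynomial.pderiv i (MvPolynomial.pderiv j p) =
      MvPolynomial.pderiv j (MvPolynomial.pderiv i p) := by
  have h : ⁅MvPolynomial.pderiv (R := K) i, MvPolynomial.pderiv (R := K) j⁆ = 0 := by
    apply MvPolynomial.derivation_ext
    intro k
    simp [Derivation.commutator_apply, MvPolynomial.pderiv_X, Pi.single_apply, apply_ite]
  have h' := congrArg (fun D : Derivation K _ _ => D p) h
  simpa [Derivation.commutator_apply, sub_eq_zero] using h'

instance : LeftCommutative
    (fun (i : Fin n) (p : MvPolynomial (Fin n) K) => MvPolynomial.pderiv i p) :=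
  ⟨fun i j p => pderiv_comm i j p⟩

/-- The iterated partial derivative `D_{i₁} ⋯ D_{i_t} p` for a multiset `{i₁, …, i_t}`. -/
noncomputable def iterD (s : Multiset (Fin n)) (p : MvPolynomial (Fin n) K) :
    MvPolynomial (Fin n) K :=
  s.foldr (fun i q => MvPolynomial.pderiv i q) p

open Classical in
/-- The children of the vertex `v` of a rooted tree: the neighbours of `v` which are one step
further away from the root. -/
noncomputable def RootedTree.children {m : ℕ} (S : RootedTree m) (v : Fin m) : Finset (Fin m) :=
  Finset.univ.filter fun w =>
    S.graph.Adj v w ∧ S.graph.dist S.root w = S.graph.dist S.root v + 1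

/-- The polynomial `𝒫_{S,H,i} = ∑_ℓ ∏_v D_{ℓ(v⁺)} H_{ℓ(v)}`, the sum running over all labellings
`ℓ : V(S) → {1, …, n}` which take the value `i` at the root; `v⁺` is the set of children
of `v`. -/
noncomputable def treePoly {m : ℕ} (S : RootedTree m) (H : PolyMap n K) : PolyMap n K := fun i =>
  ∑ ℓ : Fin m → Fin n with ℓ S.root = i,
    ∏ v : Fin m, iterD ((S.children v).val.map ℓ) (H (ℓ v))

/-- `N^{(m)} = ∑_S 𝒫_{S,H} / |Aut S|`, over the isomorphism classes of rooted trees with `m`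
vertices. -/
noncomputable def treeN [Algebra ℚ K] (H : PolyMap n K) (m : ℕ) : PolyMap n K := fun i =>
  ∑ S : RootedTree m, (1 / (S.autCard : ℚ)) • treePoly S H i

end

/-- Every polynomial map `F = X - H` of symmetric homogeneous type with `H` cubic and `(JH)^r = 0`,
in any number of variables and over any commutative `ℚ`-algebra, is invertible with inverse
`X + N^{(1)} + ⋯ + N^{(M)}`, which has degree at most `2 M + 1`. -/
def CubicSymmInversion (r M : ℕ) : Prop :=
  ∀ (K : Type u) [CommRing K] [Algebra ℚ K] (n : ℕ) (F H : PolyMap n K),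
    IsSymmHomogType 3 F H → jacobian H ^ r = 0 →
      IsInverse F (fun i => MvPolynomial.X i + ∑ m ∈ Finset.Icc 1 M, treeN H m i) ∧
      ∀ i, (MvPolynomial.X i + ∑ m ∈ Finset.Icc 1 M, treeN H m i).totalDegree ≤ 2 * M + 1

end TreeModule

namespace TreeModule

section

open MvPolynomial

/-! ### Iterated partial derivatives -/

section IterD

variable {n : ℕ} {K : Type*} [CommRing K]

/-! Since `JH` is symmetric and `H` is cubic, Euler's identity gives `H = ∇P` with a quartic `P`. A
graph `G` is turned into the polynomial `graphPoly G P`: sum over all labellings of the edges by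
coordinate directions, and at each vertex differentiate `P` along the labels of its edges. Linear
extension gives `evalTree P` on the tree module.

The defining relations of the quotient die under `evalTree P`. A vertex of degree at least 5 puts
too many derivatives on a quartic. Summing over the labels along a naked `r`-chain produces the
`r`-th power of the Hessian of `P`, which is `JH`; at an end of degree 1 the gradient is rewritten
through the Hessian by Euler's identity. By the Leibniz rule, acting by a rooted tree becomes a
differential operator applied to the polynomial of `T` (`sum_graphPoly_graft`), so the kernel is
stable under the action and contains all of `𝓒(r)` (`relSub_le_ker_evalTree`).

By orbit-stabilizer, `evalTree P (nu m)` is `1/m!` times the sum over labelled trees, and its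
gradient is `N^{(m)}`: differentiating selects a vertex as root, and moving each edge label to the
lower endpoint turns `P` into components of `H` (`legPoly_eq_rootedPoly`, `treeN_eq`). So vanishing
of `ν̄_m` forces `N^{(m)} = 0`.

Cutting a labelled tree at an oriented edge gives a quadratic recursion, whose gradient is `(m - 1)
N^{(m)} = ∑_{k+l=m} ∑_j N_j^{(k)} D_j N^{(l)}` (`nsmul_treeN`). If `N^{(m)}` vanishes for `M < m ≤
2M`, it vanishes for all larger `m`, since one of `k`, `l` exceeds `M`. Thus `𝒩 = ∑ N^{(m)} t^m` is
polynomial in `t`, and the recursion is the inviscid Burgers equation for `𝒩 / t`. The method of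
characteristics gives `𝒩 = t H(X + 𝒩)` and `𝒩(X - tH) = tH`; at `t = 1` these are the two inversion
identities (`isInverse_of_burgers`).

For the finite-dimensional case the relations are homogeneous, so the quotient is graded and
vanishes in large degrees. -/

@[simp] theorem iterD_zero (p : MvPolynomial (Fin n) K) : iterD 0 p = p := rfl

theorem iterD_cons (a : Fin n) (s : Multiset (Fin n)) (p : MvPolynomial (Fin n) K) :
    iterD (a ::ₘ s) p = pderiv a (iterD s p) := Multiset.foldr_cons _ _ _ _

@[simp] theorem iterD_singleton (a : Fin n) (p : MvPolynomial (Fin n) K) :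
    iterD {a} p = pderiv a p := Multiset.foldr_singleton _ _ _

theorem iterD_add (s t : Multiset (Fin n)) (p : MvPolynomial (Fin n) K) :
    iterD (s + t) p = iterD s (iterD t p) := by
  induction s using Multiset.induction_on with
  | empty => simp
  | cons a s ih => rw [Multiset.cons_add, iterD_cons, iterD_cons, ih]

theorem iterD_comm (s t : Multiset (Fin n)) (p : MvPolynomial (Fin n) K) :
    iterD s (iterD t p) = iterD t (iterD s p) := by
  rw [← iterD_add, add_comm, iterD_add]

theorem iterD_pderiv (s : Multiset (Fin n)) (a : Fin n) (p : MvPolynomial (Fin n) K) :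
    iterD s (pderiv a p) = iterD (a ::ₘ s) p := by
  rw [← iterD_singleton, iterD_comm, iterD_singleton, iterD_cons]

theorem iterD_map_zero (s : Multiset (Fin n)) : iterD s (0 : MvPolynomial (Fin n) K) = 0 := by
  induction s using Multiset.induction_on with
  | empty => simp
  | cons a s ih => rw [iterD_cons, ih, map_zero]

theorem iterD_map_add (s : Multiset (Fin n)) (p q : MvPolynomial (Fin n) K) :
    iterD s (p + q) = iterD s p + iterD s q := by
  induction s using Multiset.induction_on with
  | empty => simp
  | cons a s ih => rw [iterD_cons, ih, map_add, iterD_cons, iterD_cons]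

theorem iterD_map_sum {ι : Type*} (s : Multiset (Fin n)) (t : Finset ι)
    (f : ι → MvPolynomial (Fin n) K) : iterD s (∑ i ∈ t, f i) = ∑ i ∈ t, iterD s (f i) := by
  classical
  induction t using Finset.induction_on with
  | empty => simp [iterD_map_zero]
  | insert a t ha ih => rw [Finset.sum_insert ha, iterD_map_add, ih, Finset.sum_insert ha]

-- The Leibniz rule in terms of indicator multisets, so that iterating it merely adds multisets
-- factor by factor.
open Classical in
theorem pderiv_prod {W : Type*} [Fintype W] (i : Fin n) (g : W → MvPolynomial (Fin n) K) :
    pderiv i (∏ w, g w) = ∑ a, ∏ w, iterD (if w = a then {i} else 0) (g w) := by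
  have key : ∀ t : Finset W, pderiv i (∏ w ∈ t, g w)
      = ∑ a ∈ t, ∏ w ∈ t, iterD (if w = a then {i} else 0) (g w) := by
    intro t
    induction t using Finset.induction_on with
    | empty => simp
    | insert b t hb ih =>
      rw [Finset.prod_insert hb, Derivation.leibniz, ih, Finset.sum_insert hb,
        Finset.prod_insert hb, smul_eq_mul, smul_eq_mul, add_comm, Finset.mul_sum]
      congr 1
      · rw [if_pos rfl, iterD_singleton, mul_comm]
        congr 1
        refine Finset.prod_congr rfl fun w hw => ?_
        rw [if_neg (by rintro rfl; exact hb hw), iterD_zero]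
      · refine Finset.sum_congr rfl fun a ha => ?_
        rw [Finset.prod_insert hb, if_neg (by rintro rfl; exact hb ha), iterD_zero]
  exact key _

/-- The general Leibniz rule for iterated partial derivatives of a product. -/
theorem iterD_prod {C W : Type*} [Fintype C] [Fintype W] [DecidableEq W] [Fintype (C → W)]
    (β : C → Fin n) (g : W → MvPolynomial (Fin n) K) :
    iterD (∑ c, {β c}) (∏ w, g w)
      = ∑ f : C → W, ∏ w, iterD (∑ c, if f c = w then {β c} else 0) (g w) := by
  classical
  have key : ∀ (C : Type _) [Fintype C] (β : C → Fin n),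
      iterD (∑ c, {β c}) (∏ w, g w)
      = ∑ f : C → W, ∏ w, iterD (∑ c, if f c = w then {β c} else 0) (g w) := by
    intro C _
    -- Induction on `C` up to bijection: one more derivative chooses its factor independently of the
    -- others, and that choice is the value of `f` at `none`.
    refine Fintype.induction_empty_option (P := fun C _ => ∀ [Fintype (C → W)] (β : C → Fin n),
      iterD (∑ c, {β c}) (∏ w, g w)
        = ∑ f : C → W, ∏ w, iterD (∑ c, if f c = w then {β c} else 0) (g w)) ?_ ?_ ?_ C
    · intro A B _ e ih _ β
      let _ : Fintype A := Fintype.ofEquiv _ e.symm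
      rw [← e.sum_comp, ih fun a => β (e a)]
      refine Fintype.sum_equiv (e.arrowCongr (Equiv.refl W)) _ _ fun f => ?_
      refine Finset.prod_congr rfl fun w _ => ?_
      rw [← e.sum_comp]
      simp
    · intro _ β; simp
    · intro C _ ih _ β
      rw [Fintype.sum_option, iterD_add, ih fun c => β (some c), iterD_singleton, map_sum]
      refine Eq.trans ?_ (Fintype.sum_equiv (Equiv.piOptionEquivProd (β := fun _ => W)).symm _ _
        fun x => rfl)
      rw [Fintype.sum_prod_type_right]
      refine Finset.sum_congr rfl fun f _ => ?_
      rw [pderiv_prod]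
      refine Finset.sum_congr rfl fun a _ => Finset.prod_congr rfl fun w _ => ?_
      rw [Fintype.sum_option, iterD_add]
      simp only [Equiv.piOptionEquivProd, Equiv.coe_fn_symm_mk, eq_comm (a := w)]
      congr!
  convert key C β

theorem iterD_eq_zero_of_lt_card {d : ℕ} {s : Multiset (Fin n)} {p : MvPolynomial (Fin n) K}
    (hp : p.IsHomogeneous d) (hs : d < s.card) : iterD s p = 0 := by
  induction s using Multiset.induction_on generalizing d p with
  | empty => simp at hs
  | cons a s ih =>
    rw [← iterD_pderiv]
    obtain _ | d := d
    · rw [← totalDegree_zero_iff_isHomogeneous, totalDegree_eq_zero_iff_eq_C] at hp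
      rw [hp, pderiv_C, iterD_map_zero]
    · exact ih hp.pderiv (by simpa using hs)

end IterD

/-! ### Contractions along incidence structures -/

section Contract

variable {n : ℕ} {K : Type*} [CommRing K] {V V' E E' : Type*} [Fintype E] [Fintype E']

open Classical in
/-- The multiset of the labels of all edges incident with `v`. -/
noncomputable def labels (inc : E → V → Prop) (ℓ : E → Fin n) (v : V) : Multiset (Fin n) :=
  ∑ e, if inc e v then {ℓ e} else 0

theorem labels_congr {inc : E → V → Prop} {inc' : E' → V' → Prop} (e : E ≃ E') (v : V) (v' : V')
    (h : ∀ x, inc x v ↔ inc' (e x) v') (ℓ : E → Fin n) (ℓ' : E' → Fin n)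
    (hℓ : ∀ x, ℓ x = ℓ' (e x)) : labels inc ℓ v = labels inc' ℓ' v' := by
  classical
  unfold labels
  rw [← e.sum_comp]
  simp [h, hℓ]

open Classical in
theorem labels_option (inc : Option E → V → Prop) (ℓ : Option E → Fin n) (v : V) :
    labels inc ℓ v = (if inc none v then {ℓ none} else 0) +
      labels (fun e => inc (some e)) (fun e => ℓ (some e)) v := by
  unfold labels; rw [Fintype.sum_option]

theorem labels_sum (inc : E ⊕ E' → V → Prop) (ℓ : E ⊕ E' → Fin n) (v : V) :
    labels inc ℓ v = labels (fun e => inc (.inl e)) (fun e => ℓ (.inl e)) v +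
      labels (fun e => inc (.inr e)) (fun e => ℓ (.inr e)) v := by
  unfold labels; rw [Fintype.sum_sum_type]

theorem labels_eq_zero {inc : E → V → Prop} {v : V} (h : ∀ e, ¬ inc e v) (ℓ : E → Fin n) :
    labels inc ℓ v = 0 := by
  simp [labels, h]

variable [Fintype V] [Fintype V']

open Classical in
/-- The sum over all labellings of the edges of the product over the vertices `v` of the
derivatives of `P` in the directions of the labels around `v`. -/
noncomputable def contract (inc : E → V → Prop) (P : MvPolynomial (Fin n) K) :
    MvPolynomial (Fin n) K :=
  ∑ ℓ : E → Fin n, ∏ v, iterD (labels inc ℓ v) P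

theorem contract_eq [Fintype (E → Fin n)] (inc : E → V → Prop) (P : MvPolynomial (Fin n) K) :
    contract inc P = ∑ ℓ : E → Fin n, ∏ v, iterD (labels inc ℓ v) P := by
  unfold contract
  congr!

theorem contract_congr {inc : E → V → Prop} {inc' : E' → V' → Prop} (e : E ≃ E') (v : V ≃ V')
    (h : ∀ x y, inc x y ↔ inc' (e x) (v y)) (P : MvPolynomial (Fin n) K) :
    contract inc P = contract inc' P := by
  classical
  refine Fintype.sum_equiv (e.arrowCongr (Equiv.refl _)) _ _ fun ℓ => ?_
  refine Fintype.prod_equiv v _ _ fun y => ?_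
  rw [labels_congr e y (v y) (fun x => h x y) ℓ
    (e.arrowCongr (Equiv.refl _) ℓ) (fun x => by simp)]

open Classical in
/-- The contraction of an incidence structure with an additional leg with label `i` at the
vertex `a`. -/
noncomputable def legContract (inc : E → V → Prop) (a : V) (i : Fin n)
    (P : MvPolynomial (Fin n) K) : MvPolynomial (Fin n) K :=
  ∑ ℓ : E → Fin n, ∏ v, iterD ((if v = a then {i} else 0) + labels inc ℓ v) P

/-- By Leibniz the new derivative hits the factor of a single vertex, where it acts as a leg. -/
theorem pderiv_contract (inc : E → V → Prop) (i : Fin n) (P : MvPolynomial (Fin n) K) :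
    pderiv i (contract inc P) = ∑ a, legContract inc a i P := by
  classical
  simp only [contract, map_sum, legContract]
  rw [Finset.sum_comm]
  refine Finset.sum_congr rfl fun ℓ _ => ?_
  rw [pderiv_prod]
  simp only [iterD_add]

end Contract

/-! ### Polynomials of graphs -/

section GraphPoly

variable {n : ℕ} {K : Type*} [CommRing K] {V W : Type*} [Fintype V] [Fintype W]

/-- Incidence of edges and vertices. -/
def edgeInc (G : SimpleGraph V) (e : G.edgeSet) (v : V) : Prop := v ∈ e.1

/-- The polynomial `∑_ℓ ∏_v D_{ℓ(v)} P` of a graph, where `ℓ` runs over the labellings of the edges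
and `ℓ(v)` are the labels of the edges at `v`. -/
noncomputable def graphPoly (G : SimpleGraph V) (P : MvPolynomial (Fin n) K) :
    MvPolynomial (Fin n) K :=
  letI := Fintype.ofFinite G.edgeSet
  contract (edgeInc G) P

theorem graphPoly_eq (G : SimpleGraph V) [Fintype G.edgeSet] (P : MvPolynomial (Fin n) K) :
    graphPoly G P = contract (edgeInc G) P := by
  unfold graphPoly
  congr!

/-- Allows any enumeration of the edges as index type; for grafts, chains and joins this type is a
sum, so that the labellings split. -/
theorem graphPoly_eq_contract {E : Type*} [Fintype E] (G : SimpleGraph V) (ε : E → Sym2 V)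
    (hε : Function.Injective ε) (hr : ∀ x, x ∈ G.edgeSet ↔ ∃ e, ε e = x)
    (P : MvPolynomial (Fin n) K) : graphPoly G P = contract (fun e v => v ∈ ε e) P := by
  let _ := Fintype.ofFinite G.edgeSet
  rw [graphPoly_eq]
  symm
  refine contract_congr (inc' := edgeInc G) (Equiv.ofBijective (fun e => ⟨ε e, (hr _).2 ⟨e, rfl⟩⟩) ⟨?_, ?_⟩)
    (Equiv.refl V) (fun _ _ => Iff.rfl) P
  · intro e e' h
    exact hε (congrArg Subtype.val h)
  · rintro ⟨x, hx⟩
    obtain ⟨e, he⟩ := (hr x).1 hx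
    exact ⟨e, Subtype.ext he⟩

theorem graphPoly_iso {G : SimpleGraph V} {G' : SimpleGraph W} (f : G ≃g G')
    (P : MvPolynomial (Fin n) K) : graphPoly G P = graphPoly G' P := by
  let _ := Fintype.ofFinite G.edgeSet
  let _ := Fintype.ofFinite G'.edgeSet
  rw [graphPoly_eq, graphPoly_eq]
  refine contract_congr (inc := edgeInc G) (inc' := edgeInc G') f.mapEdgeSet f.toEquiv ?_ P
  intro x y
  simp only [edgeInc]
  rw [show ((f.mapEdgeSet x).1) = Sym2.map f x.1 from rfl, Sym2.mem_map]
  constructor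
  · intro h; exact ⟨y, h, rfl⟩
  · rintro ⟨z, hz, h⟩; rwa [← f.toEquiv.injective h]

open Classical in
theorem card_labels (G : SimpleGraph V) {E : Type*} [Fintype E] (ε : E → Sym2 V)
    (hε : Function.Injective ε) (hr : ∀ x, x ∈ G.edgeSet ↔ ∃ e, ε e = x) (ℓ : E → Fin n) (v : V) :
    (labels (fun e v => v ∈ ε e) ℓ v).card = G.degree v := by
  rw [labels, Multiset.card_sum, ← G.card_incidenceFinset_eq_degree v]
  simp only [apply_ite Multiset.card, Multiset.card_singleton, Multiset.card_zero]
  refine Eq.trans (b := (Finset.univ.filter fun e => v ∈ ε e).card) ?_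
    (Finset.card_bij (fun e _ => ε e) ?_ (fun _ _ _ _ h => hε h) ?_)
  · rw [Finset.card_filter]
    congr!
  · intro e he
    rw [SimpleGraph.mem_incidenceFinset]
    exact ⟨(hr _).2 ⟨e, rfl⟩, by simpa using he⟩
  · intro x hx
    rw [SimpleGraph.mem_incidenceFinset] at hx
    obtain ⟨e, rfl⟩ := (hr x).1 hx.1
    exact ⟨e, by simpa using hx.2, rfl⟩

-- The factor at `v` carries one derivative per incident edge, more than the degree of `P`.
open Classical in
theorem graphPoly_eq_zero_of_degree {d : ℕ} {G : SimpleGraph V} {v : V} (hv : d < G.degree v)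
    {P : MvPolynomial (Fin n) K} (hP : P.IsHomogeneous d) : graphPoly G P = 0 := by
  rw [graphPoly_eq]
  refine Finset.sum_eq_zero fun ℓ _ => Finset.prod_eq_zero (Finset.mem_univ v) ?_
  refine iterD_eq_zero_of_lt_card hP (hv.trans_eq (Eq.symm ?_))
  exact card_labels G (fun e : G.edgeSet => e.1) Subtype.val_injective (by simp) ℓ v

end GraphPoly

/-! ### Grafting and the evaluation of the tree module -/

section Graft

variable {n : ℕ} {K : Type*} [CommRing K]

/-- An edge `ρc` of `S` is rerouted to `f c`, and every other edge is kept. The endpoints are all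
that label counting uses. -/
theorem exists_graft_edge {V W : Type} {S : SimpleGraph V} {ρ : V} {T : SimpleGraph W}
    (f : {c : V // S.Adj ρ c} → W) (e : S.edgeSet) :
    ∃ ε ∈ (graft S ρ T f).edgeSet, (∀ u : {u : V // u ≠ ρ}, .inl u ∈ ε ↔ u.1 ∈ e.1) ∧
      ∀ x : W, .inr x ∈ ε ↔ ∃ c : {c : V // S.Adj ρ c}, e.1 = s(ρ, c.1) ∧ f c = x := by
  obtain ⟨e, he⟩ := e
  induction e using Sym2.ind with
  | _ a b =>
    have hab : S.Adj a b := he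
    have key : ∀ b, S.Adj ρ b → ∃ ε ∈ (graft S ρ T f).edgeSet,
        (∀ u : {u : V // u ≠ ρ}, .inl u ∈ ε ↔ u.1 ∈ s(ρ, b)) ∧
        ∀ x : W, .inr x ∈ ε ↔ ∃ c : {c : V // S.Adj ρ c}, s(ρ, b) = s(ρ, c.1) ∧ f c = x := by
      intro b hb
      refine ⟨s(.inl ⟨b, hb.ne'⟩, .inr (f ⟨b, hb⟩)), ?_, ?_, ?_⟩
      · exact ⟨hb, rfl⟩
      · intro u
        simp [Subtype.ext_iff, u.2]
      · intro x
        constructor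
        · intro h
          refine ⟨⟨b, hb⟩, rfl, ?_⟩
          simpa [eq_comm] using h
        · rintro ⟨⟨c, hc⟩, h1, h2⟩
          obtain rfl : b = c := Sym2.congr_right.1 h1
          simp [h2]
    by_cases ha : a = ρ
    · subst ha; exact key b hab
    by_cases hb : b = ρ
    · subst hb
      rw [show (⟨s(a, b), he⟩ : S.edgeSet).1 = s(b, a) from Sym2.eq_swap]
      exact key a hab.symm
    · refine ⟨s(.inl ⟨a, ha⟩, .inl ⟨b, hb⟩), hab, ?_, ?_⟩
      · intro u; simp [Subtype.ext_iff]
      · intro x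
        constructor
        · intro h; simp at h
        · rintro ⟨c, h1, -⟩
          rcases Sym2.eq_iff.1 h1 with h | h
          · exact absurd h.1 ha
          · exact absurd h.2 hb

/-- The differential operator by which a rooted tree acts on polynomials. -/
noncomputable def graftOp {V : Type} [Fintype V] (S : SimpleGraph V) (ρ : V)
    (P : MvPolynomial (Fin n) K) : MvPolynomial (Fin n) K →+ MvPolynomial (Fin n) K := by
  classical exact
  { toFun := fun x => ∑ ℓ : S.edgeSet → Fin n,
      (∏ u : {u : V // u ≠ ρ}, iterD (labels (edgeInc S) ℓ u) P) *
        iterD (labels (edgeInc S) ℓ ρ) x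
    map_zero' := by simp [iterD_map_zero]
    map_add' := fun x y => by simp [iterD_map_add, mul_add, Finset.sum_add_distrib] }

theorem graftOp_apply {V : Type} [Fintype V] (S : SimpleGraph V) (ρ : V) [Fintype S.edgeSet]
    [Fintype (S.edgeSet → Fin n)] [Fintype {u : V // u ≠ ρ}] (P x : MvPolynomial (Fin n) K) :
    graftOp S ρ P x = ∑ ℓ : S.edgeSet → Fin n,
      (∏ u : {u : V // u ≠ ρ}, iterD (labels (edgeInc S) ℓ u) P) *
        iterD (labels (edgeInc S) ℓ ρ) x := by
  unfold graftOp
  simp only [AddMonoidHom.coe_mk, ZeroHom.coe_mk]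
  congr!

/-- This is the Leibniz rule: the labels of the edges at `ρ` are directions of differentiation, and
`f` records which vertex factor of `T` each derivative hits. The outcome depends on `T` only through
its polynomial. -/
theorem sum_graphPoly_graft {V W : Type} [Fintype V] [Fintype W] (S : SimpleGraph V) (ρ : V)
    [Fintype {u : V // u ≠ ρ}] (T : SimpleGraph W) [Fintype ({c : V // S.Adj ρ c} → W)] (P : MvPolynomial (Fin n) K) :
    ∑ f : {c : V // S.Adj ρ c} → W, graphPoly (graft S ρ T f) P
      = graftOp S ρ P (graphPoly T P) := by
  classical
  -- Edges at `ρ` correspond to the children of `ρ`; this rewrites sums over the former as sums over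
  -- the latter.
  have hsum : ∀ (ℓ : S.edgeSet → Fin n) (p : S.edgeSet → Prop) (q : {c : V // S.Adj ρ c} → Prop),
      (∀ e, p e → ∃ c : {c : V // S.Adj ρ c}, e.1 = s(ρ, c.1)) →
      (∀ c, q c ↔ p ⟨s(ρ, c.1), c.2⟩) →
      (∑ e, if p e then ({ℓ e} : Multiset (Fin n)) else 0)
        = ∑ c : {c : V // S.Adj ρ c}, if q c then {ℓ ⟨s(ρ, c.1), c.2⟩} else 0 := by
    intro ℓ p q h1 h2
    symm
    refine Fintype.sum_of_injective
      (fun c : {c : V // S.Adj ρ c} => (⟨s(ρ, c.1), c.2⟩ : S.edgeSet)) ?_ _ _ ?_ ?_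
    · intro c c' h
      have := congrArg Subtype.val h
      exact Subtype.ext (Sym2.congr_right.1 this)
    · intro e he
      rw [if_neg]
      intro hp
      obtain ⟨c, hc⟩ := h1 e hp
      exact he ⟨c, Subtype.ext hc.symm⟩
    · intro c
      simp [h2]
  have hone : ∀ f : {c : V // S.Adj ρ c} → W, graphPoly (graft S ρ T f) P
      = ∑ ℓ : S.edgeSet → Fin n, ∑ ℓ' : T.edgeSet → Fin n,
        (∏ u : {u : V // u ≠ ρ}, iterD (labels (edgeInc S) ℓ u) P) *
        ∏ w, iterD (∑ c, if f c = w then {ℓ ⟨s(ρ, c.1), c.2⟩} else 0)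
          (iterD (labels (edgeInc T) ℓ' w) P) := by
    intro f
    choose ε hε hl hr using exists_graft_edge (S := S) (ρ := ρ) (T := T) f
    rw [graphPoly_eq_contract (E := S.edgeSet ⊕ T.edgeSet) _
      (Sum.elim ε fun e => Sym2.map Sum.inr e.1)]
    · rw [contract_eq, ← (Equiv.sumArrowEquivProdArrow _ _ _).symm.sum_comp,
        Fintype.sum_prod_type]
      refine Finset.sum_congr rfl fun ℓ _ => Finset.sum_congr rfl fun ℓ' _ => ?_
      rw [Fintype.prod_sum_type]
      congr 1
      · refine Finset.prod_congr rfl fun u _ => ?_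
        rw [labels_sum]
        simp only [Sum.elim_inl, Sum.elim_inr]
        rw [labels_eq_zero (inc := fun (e : T.edgeSet) v => v ∈ Sym2.map Sum.inr e.1) (by simp),
          add_zero]
        congr 1
        exact labels_congr (Equiv.refl _) _ _ (fun e => hl e u) _ _ fun _ => rfl
      · refine Finset.prod_congr rfl fun w _ => ?_
        rw [labels_sum, iterD_add]
        simp only [Sum.elim_inl, Sum.elim_inr]
        congr 1
        · unfold labels
          refine hsum ℓ (fun e => Sum.inr w ∈ ε e) (fun c => f c = w) ?_ ?_
          · intro e he
            obtain ⟨c, hc, -⟩ := (hr e w).1 he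
            exact ⟨c, hc⟩
          · intro c
            rw [hr]
            constructor
            · intro h; exact ⟨c, rfl, h⟩
            · rintro ⟨c', h1, h2⟩
              obtain rfl : c = c' := Subtype.ext (Sym2.congr_right.1 h1)
              exact h2
        · congr 1
          exact labels_congr (Equiv.refl _) _ _ (fun e => by simp [edgeInc]) _ _ fun _ => rfl
    · have hinj : Function.Injective ε := by
        have key : ∀ e e', ε e = ε e' → ∀ x, x ∈ e.1 → x ∈ e'.1 := by
          intro e e' h x hx
          have h1 : ∀ u, u ≠ ρ → (u ∈ e.1 ↔ u ∈ e'.1) := fun u hu => by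
            rw [← hl e ⟨u, hu⟩, ← hl e' ⟨u, hu⟩, h]
          by_cases hxρ : x = ρ
          · obtain ⟨y, hy⟩ := Sym2.mem_iff_exists.1 hx
            have hadj : S.Adj x y := by
              have := e.2; rwa [hy] at this
            subst hxρ
            have h2 : Sum.inr (f ⟨y, hadj⟩) ∈ ε e := (hr e _).2 ⟨⟨y, hadj⟩, hy, rfl⟩
            rw [h] at h2
            obtain ⟨c, hc, -⟩ := (hr e' _).1 h2
            rw [hc]; simp
          · exact (h1 x hxρ).1 hx
        intro e e' h
        exact Subtype.ext (Sym2.ext fun x => ⟨key e e' h x, key e' e h.symm x⟩)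
      -- Each edge of `S` has an endpoint other than `ρ`, which survives on the left side of the
      -- graft.
      have hno : ∀ (e : S.edgeSet) (e' : T.edgeSet), ε e ≠ Sym2.map Sum.inr e'.1 := by
        rintro ⟨e, he⟩ e' h
        have hx : ∃ x, x ∈ e ∧ x ≠ ρ := by
          induction e using Sym2.ind with
          | _ a b =>
            by_cases ha : a = ρ
            · exact ⟨b, by simp, by rintro rfl; exact S.loopless.irrefl _ (ha ▸ he)⟩
            · exact ⟨a, by simp, ha⟩
        obtain ⟨x, hx, hne⟩ := hx
        have := (hl ⟨e, he⟩ ⟨x, hne⟩).2 hx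
        rw [h] at this
        simp at this
      rintro (e | e) (e' | e') h
      · rw [hinj h]
      · exact absurd h (hno e e')
      · exact absurd h.symm (hno e' e)
      · have : e.1 = e'.1 := Sym2.map.injective Sum.inr_injective h
        rw [Subtype.ext this]
    · intro x
      constructor
      · have hmem : ∀ (a b : {u : V // u ≠ ρ} ⊕ W) (z : Sym2 _), a ≠ b → a ∈ z → b ∈ z →
            z = s(a, b) := fun a b z hab ha hb => ((Sym2.mem_and_mem_iff hab).1 ⟨ha, hb⟩)
        have hlr : ∀ (u : {u : V // u ≠ ρ}) (y : W) (h : S.Adj ρ u.1), f ⟨u.1, h⟩ = y →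
            ε ⟨s(ρ, u.1), h⟩ = s(.inl u, .inr y) := by
          intro u y h hy
          refine hmem _ _ _ (by simp) ((hl _ _).2 (by simp)) ((hr _ _).2 ⟨⟨u.1, h⟩, rfl, hy⟩)
        induction x using Sym2.ind with
        | _ a b =>
          rcases a with u | y <;> rcases b with v | z <;> intro h
          · have h' : S.Adj u.1 v.1 := h
            refine ⟨.inl ⟨s(u.1, v.1), h'⟩, ?_⟩
            refine hmem _ _ _ ?_ ((hl _ _).2 (by simp)) ((hl _ _).2 (by simp))
            intro h''
            exact h'.ne (congrArg Subtype.val (Sum.inl_injective h''))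
          · obtain ⟨h1, h2⟩ := h
            exact ⟨.inl ⟨_, h1⟩, hlr u z h1 h2⟩
          · obtain ⟨h1, h2⟩ := h
            exact ⟨.inl ⟨_, h1⟩, (hlr v y h1 h2).trans Sym2.eq_swap⟩
          · exact ⟨.inr ⟨s(y, z), h⟩, rfl⟩
      · rintro ⟨e | e, rfl⟩
        · exact hε e
        · obtain ⟨e, he⟩ := e
          induction e using Sym2.ind with
          | _ a b => exact he
  rw [Finset.sum_congr rfl fun f _ => hone f, Finset.sum_comm, graftOp_apply]
  refine Finset.sum_congr rfl fun ℓ _ => ?_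
  rw [Finset.sum_comm, graphPoly_eq, contract_eq, iterD_map_sum, Finset.mul_sum]
  refine Finset.sum_congr rfl fun ℓ' _ => ?_
  rw [← Finset.mul_sum]
  congr 1
  have hρ : labels (edgeInc S) ℓ ρ
      = ∑ c : {c : V // S.Adj ρ c}, {ℓ ⟨s(ρ, c.1), c.2⟩} := by
    have := hsum ℓ (fun e => ρ ∈ e.1) (fun _ => True) ?_ ?_
    · unfold labels edgeInc; simpa using this
    · intro e he
      obtain ⟨y, hy⟩ := Sym2.mem_iff_exists.1 he
      have hadj : S.Adj ρ y := by
        have := e.2; rwa [hy] at this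
      exact ⟨⟨y, hadj⟩, hy⟩
    · simp
  rw [hρ, iterD_prod]

theorem FreeTree.graph_mk_iso {m : ℕ} (G : {G : SimpleGraph (Fin m) // G.IsTree}) :
    Nonempty ((FreeTree.graph (Quotient.mk (freeTreeSetoid m) G)) ≃g G.1) :=
  Quotient.mk_out (s := freeTreeSetoid m) G

theorem graphPoly_ofGraph {V : Type} [Fintype V] (G : SimpleGraph V) (hG : G.IsTree)
    (P : MvPolynomial (Fin n) K) : graphPoly (FreeTree.ofGraph G hG).2.graph P = graphPoly G P := by
  obtain ⟨f⟩ := FreeTree.graph_mk_iso ⟨G.map (Fintype.equivFin V).toEmbedding,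
      (SimpleGraph.Iso.isTree_iff (SimpleGraph.Iso.map (Fintype.equivFin V) G)).1 hG⟩
  rw [graphPoly_iso (SimpleGraph.Iso.map (Fintype.equivFin V) G)]
  exact graphPoly_iso f P

end Graft

/-! ### Evaluation of the tree module and stability of its kernel -/

section Eval

variable {n : ℕ} {K : Type*} [CommRing K] [Algebra ℚ K]

/-- The linear map sending a tree to its polynomial. -/
noncomputable def evalTree (P : MvPolynomial (Fin n) K) : TreeMod →ₗ[ℚ] MvPolynomial (Fin n) K :=
  Finsupp.linearCombination ℚ fun T : Σ m, FreeTree m => graphPoly T.2.graph P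

theorem evalTree_tree {m : ℕ} (T : FreeTree m) (P : MvPolynomial (Fin n) K) :
    evalTree P (tree T) = graphPoly T.graph P := by
  simp [evalTree, tree]

theorem evalTree_act_single (S : Σ k, RootedTree k) (P : MvPolynomial (Fin n) K) :
    evalTree P ∘ₗ act (Finsupp.single S 1)
      = (graftOp S.2.graph S.2.root P).toRatLinearMap ∘ₗ evalTree P := by
  classical
  refine Finsupp.lhom_ext' fun T => LinearMap.ext_ring ?_
  simp only [act, LinearMap.comp_apply, Finsupp.lsingle_apply, Finsupp.linearCombination_single,
    one_smul, map_sum, evalTree, AddMonoidHom.coe_toRatLinearMap]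
  rw [← sum_graphPoly_graft]
  exact Finset.sum_congr rfl fun f _ => graphPoly_ofGraph _ _ P

theorem evalTree_act_eq_zero {P : MvPolynomial (Fin n) K} {x : TreeMod} (hx : evalTree P x = 0)
    (h : RootedMod) : evalTree P (act h x) = 0 := by
  induction h using Finsupp.induction_linear with
  | zero => simp
  | add h h' ih ih' => rw [map_add, LinearMap.add_apply, map_add, ih, ih', add_zero]
  | single S c =>
    rw [← mul_one c, ← smul_eq_mul, ← Finsupp.smul_single, map_smul, LinearMap.smul_apply,
      map_smul, ← LinearMap.comp_apply, evalTree_act_single, LinearMap.comp_apply, hx, map_zero,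
      smul_zero]

/-- The kernel is itself a subspace stable under the action, so it competes in the infimum defining
`hSpan`. -/
theorem hSpan_le_ker_evalTree {A : Set TreeMod} {P : MvPolynomial (Fin n) K}
    (hA : ∀ x ∈ A, evalTree P x = 0) : hSpan A ≤ LinearMap.ker (evalTree P) :=
  sInf_le ⟨fun x hx => hA x hx, fun h _ hx => evalTree_act_eq_zero hx h⟩

end Eval

/-! ### Naked chains -/

/-- Entries of a matrix power are sums over walks; the induction absorbs the first step into the
vector `a`. -/
theorem sum_chain_eq_dotProduct {R ι : Type*} [CommRing R] [Fintype ι] [DecidableEq ι]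
    (M : Matrix ι ι R) (k : ℕ) (a c : ι → R) :
    ∑ x : Fin (k + 1) → ι, a (x 0) * (∏ j : Fin k, M (x j.castSucc) (x j.succ)) * c (x (Fin.last k))
      = a ⬝ᵥ ((M ^ k).mulVec c) := by
  induction k generalizing a with
  | zero =>
    rw [← (Equiv.funUnique (Fin 1) ι).symm.sum_comp]
    simp [dotProduct]
  | succ k ih =>
    rw [← (Fin.consEquiv fun _ => ι).sum_comp, Fintype.sum_prod_type_right]
    have : ∀ x : Fin (k + 1) → ι, ∑ i, a i * (M i (x 0) *
        ∏ j : Fin k, M (x j.castSucc) (x j.succ)) * c (x (Fin.last k))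
        = (Matrix.vecMul a M) (x 0) * (∏ j : Fin k, M (x j.castSucc) (x j.succ)) *
          c (x (Fin.last k)) := by
      intro x
      rw [Matrix.vecMul, dotProduct, Finset.sum_mul, Finset.sum_mul]
      exact Finset.sum_congr rfl fun i _ => by ring
    have h2 : ∀ x : Fin (k + 1) → ι, ∑ i, a ((Fin.consEquiv fun _ => ι) (i, x) 0) *
        (∏ j : Fin (k + 1), M ((Fin.consEquiv fun _ => ι) (i, x) j.castSucc)
          ((Fin.consEquiv fun _ => ι) (i, x) j.succ)) *
        c ((Fin.consEquiv fun _ => ι) (i, x) (Fin.last (k + 1)))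
        = (Matrix.vecMul a M) (x 0) * (∏ j : Fin k, M (x j.castSucc) (x j.succ)) *
          c (x (Fin.last k)) := by
      intro x
      rw [← this]
      refine Finset.sum_congr rfl fun i _ => ?_
      rw [Fin.prod_univ_succ, ← Fin.succ_last]
      simp [Fin.consEquiv]
    rw [Finset.sum_congr rfl fun x _ => h2 x, ih, ← Matrix.dotProduct_mulVec, Matrix.mulVec_mulVec,
      ← pow_succ']

section Chain

variable {n : ℕ} {K : Type*} [CommRing K] {V : Type} [Fintype V]

/-- The Hessian matrix of a polynomial. -/
noncomputable def hessian (P : MvPolynomial (Fin n) K) :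
    Matrix (Fin n) (Fin n) (MvPolynomial (Fin n) K) :=
  Matrix.of fun i j => pderiv i (pderiv j P)

-- Fix the labels off the chain. Inner chain vertices contribute Hessian entries, and each end
-- contributes a Hessian applied to a fixed vector, so summing over the chain labels gives `a ·
-- (hessian P ^ r) c` times a constant factor. The vector `u` serves the ends of degree 1.
set_option maxHeartbeats 1000000 in
theorem graphPoly_eq_zero_of_hasNakedChain {G : SimpleGraph V} {r : ℕ} (hr : 0 < r)
    (hG : HasNakedChain G r) {P : MvPolynomial (Fin n) K} (hP : hessian P ^ r = 0)
    (u : Fin n → MvPolynomial (Fin n) K) (hu : ∀ j, pderiv j P = ∑ b, u b * hessian P b j) :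
    graphPoly G P = 0 := by
  classical
  obtain ⟨v, hv, hadj, hdeg⟩ := hG
  have hsymm : ∀ i j, hessian P i j = hessian P j i := fun i j => pderiv_comm i j P
  -- An end has at most one label `i` off the chain: with none, `a = u`; with one, `a` is the `i`-th
  -- basis vector.
  have hend : ∀ s : Multiset (Fin n), s.card ≤ 1 → ∃ a : Fin n → MvPolynomial (Fin n) K,
      ∀ x, iterD ({x} + s) P = ∑ b, a b * hessian P b x := by
    intro s hs
    rcases Nat.le_one_iff_eq_zero_or_eq_one.1 hs with h | h
    · rw [Multiset.card_eq_zero] at h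
      subst h
      exact ⟨u, fun x => by rw [add_zero, iterD_singleton, hu]⟩
    · obtain ⟨i, rfl⟩ := Multiset.card_eq_one.1 h
      refine ⟨Pi.single i 1, fun x => ?_⟩
      rw [iterD_add, iterD_singleton, iterD_singleton]
      simpa [Pi.single_apply, hessian] using hsymm x i
  obtain ⟨r, rfl⟩ := Nat.exists_eq_succ_of_ne_zero hr.ne'
  obtain _ | k := r
  -- A chain with one vertex has no edges to sum over. Here the Hessian, hence the gradient, is
  -- zero, and the vertex carries at least one derivative.
  · have h0 : hessian P = 0 := by simpa using hP
    have h1 : ∀ j, pderiv j P = 0 := fun j => by rw [hu, h0]; simp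
    rw [graphPoly_eq]
    refine Finset.sum_eq_zero fun ℓ _ => Finset.prod_eq_zero (Finset.mem_univ (v 0)) ?_
    have hc := card_labels G (fun e : G.edgeSet => e.1) Subtype.val_injective (by simp) ℓ (v 0)
    have hpos : (labels (edgeInc G) ℓ (v 0)).card ≠ 0 := by
      refine (hc.trans_ne ?_)
      rcases hdeg 0 with h | h <;> omega
    rw [Ne, Multiset.card_eq_zero] at hpos
    obtain ⟨a, ha⟩ := Multiset.exists_mem_of_ne_zero hpos
    obtain ⟨t, ht⟩ := Multiset.exists_cons_of_mem ha
    rw [ht, ← iterD_pderiv, h1, iterD_map_zero]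
  -- Now `r = k + 2`: the chain has `k + 1` edges and `k` inner vertices.
  set ch : Fin (k + 1) → Sym2 V := fun i => s(v i.castSucc, v i.succ) with hch
  have hchmem : ∀ i, ch i ∈ G.edgeSet := fun i => hadj _ _ (by simp)
  set ε : Fin (k + 1) ⊕ {e : G.edgeSet // e.1 ∉ Set.range ch} → Sym2 V :=
    Sum.elim ch fun e => e.1.1 with hε
  have hchinj : Function.Injective ch := by
    intro i j h
    rw [hch] at h
    rcases Sym2.eq_iff.1 h with h | h
    · exact Fin.castSucc_injective _ (hv h.1)
    · have h1 := congrArg Fin.val (hv h.1)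
      have h2 := congrArg Fin.val (hv h.2)
      simp at h1 h2; omega
  have hεinj : Function.Injective ε := by
    rintro (i | e) (j | e') h
    · rw [hchinj h]
    · exact absurd ⟨i, h⟩ e'.2
    · exact absurd ⟨j, h.symm⟩ e.2
    · rw [Subtype.ext (Subtype.ext h)]
  have hεr : ∀ x, x ∈ G.edgeSet ↔ ∃ e, ε e = x := by
    intro x
    constructor
    · intro hx
      by_cases h : x ∈ Set.range ch
      · obtain ⟨i, hi⟩ := h
        exact ⟨.inl i, hi⟩
      · exact ⟨.inr ⟨⟨x, hx⟩, h⟩, rfl⟩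
    · rintro ⟨i | e, rfl⟩
      · exact hchmem i
      · exact e.1.2
  rw [graphPoly_eq_contract G ε hεinj hεr, contract_eq,
    ← (Equiv.sumArrowEquivProdArrow _ _ _).symm.sum_comp, Fintype.sum_prod_type_right]
  refine Finset.sum_eq_zero fun ℓ _ => ?_
  set out : V → Multiset (Fin n) := fun w =>
    labels (fun (e : {e : G.edgeSet // e.1 ∉ Set.range ch}) v => v ∈ e.1.1) ℓ w with hout
  have hlab : ∀ (x : Fin (k + 1) → Fin n) (w : V), labels (fun e v => v ∈ ε e)
      ((Equiv.sumArrowEquivProdArrow _ _ _).symm (x, ℓ)) w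
      = labels (fun i v => v ∈ ch i) x w + out w := by
    intro x w
    rw [labels_sum]
    rfl
  have hinner : ∀ (x : Fin (k + 1) → Fin n) (j : Fin (k + 2)), labels (fun i v => v ∈ ch i) x (v j)
      = (∑ i, if j = Fin.castSucc i then {x i} else 0) + ∑ i, if j = Fin.succ i then {x i} else 0 := by
    intro x j
    rw [← Finset.sum_add_distrib]
    refine Finset.sum_congr rfl fun i _ => ?_
    have h1 : v j ∈ ch i ↔ j = i.castSucc ∨ j = i.succ := by
      simp [hch, hv.eq_iff]
    have h2 : ¬ (j = i.castSucc ∧ j = i.succ) := by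
      rintro ⟨h, h'⟩
      have := congrArg Fin.val (h.symm.trans h')
      simp at this
    simp only [h1]
    by_cases ha : j = i.castSucc
    · rw [if_pos (Or.inl ha), if_pos ha, if_neg fun hb => h2 ⟨ha, hb⟩, add_zero]
    · by_cases hb : j = i.succ
      · rw [if_pos (Or.inr hb), if_neg ha, if_pos hb, zero_add]
      · rw [if_neg (by tauto), if_neg ha, if_neg hb, add_zero]
  have hin0 : ∀ x : Fin (k + 1) → Fin n, labels (fun i v => v ∈ ch i) x (v 0) = {x 0} := by
    intro x
    rw [hinner, Finset.sum_eq_single 0, Finset.sum_eq_zero, add_zero, if_pos Fin.castSucc_zero.symm]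
    · intro i _
      rw [if_neg (Fin.succ_ne_zero i).symm]
    · intro i _ hi
      rw [if_neg]
      intro h
      exact hi (Fin.castSucc_injective _ (h.symm.trans Fin.castSucc_zero.symm))
    · simp
  have hinl : ∀ x : Fin (k + 1) → Fin n,
      labels (fun i v => v ∈ ch i) x (v (Fin.last _)) = {x (Fin.last k)} := by
    intro x
    rw [hinner, Finset.sum_eq_zero, Finset.sum_eq_single (Fin.last k),
      zero_add, if_pos (Fin.succ_last _).symm]
    · intro i _ hi
      rw [if_neg]
      intro h
      exact hi (Fin.succ_injective _ (h.symm.trans (Fin.succ_last _).symm))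
    · simp
    · intro i _
      rw [if_neg (Fin.castSucc_lt_last i).ne']
  have hinm : ∀ (x : Fin (k + 1) → Fin n) (i : Fin k),
      labels (fun i v => v ∈ ch i) x (v i.castSucc.succ) = {x i.castSucc} + {x i.succ} := by
    intro x i
    rw [hinner, add_comm, Finset.sum_eq_single i.castSucc, Finset.sum_eq_single i.succ,
      if_pos rfl, if_pos (Fin.succ_castSucc i)]
    · intro j _ hj
      rw [if_neg]
      rw [Fin.succ_castSucc]
      intro h
      exact hj (Fin.castSucc_injective _ h.symm)
    · simp
    · intro j _ hj
      rw [if_neg]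
      intro h
      exact hj (Fin.succ_injective _ h.symm)
    · simp
  have hcard : ∀ (x : Fin (k + 1) → Fin n) (j : Fin (k + 2)),
      (labels (fun i v => v ∈ ch i) x (v j)).card + (out (v j)).card = G.degree (v j) := by
    intro x j
    rw [← Multiset.card_add, ← hlab, card_labels G ε hεinj hεr]
  have hprod : ∀ x : Fin (k + 1) → Fin n, ∏ w, iterD (labels (fun i v => v ∈ ch i) x w + out w) P
      = (∏ j, iterD (labels (fun i v => v ∈ ch i) x (v j) + out (v j)) P) *
        ∏ w : {w // w ∉ Set.range v}, iterD (out w) P := by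
    intro x
    rw [← Fintype.prod_subtype_mul_prod_subtype (fun w => w ∈ Set.range v)]
    congr 1
    · symm
      let _ : Fintype {w // w ∈ Set.range v} := Subtype.fintype _
      refine Fintype.prod_bijective (fun j => (⟨v j, j, rfl⟩ : {w // w ∈ Set.range v}))
        ⟨fun i j h => hv (congrArg Subtype.val h), ?_⟩ _ _ fun j => rfl
      rintro ⟨_, j, rfl⟩
      exact ⟨j, rfl⟩
    · refine Finset.prod_congr rfl fun w _ => ?_
      rw [labels_eq_zero, zero_add]
      intro i hi
      rcases Sym2.mem_iff.1 hi with h | h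
      · exact w.2 ⟨_, h.symm⟩
      · exact w.2 ⟨_, h.symm⟩
  -- The multisets `out` do not involve the chain labels, but bounding their size by the degrees
  -- needs one chain labelling `x₀`.
  rcases isEmpty_or_nonempty (Fin (k + 1) → Fin n) with hempty | ⟨⟨x₀⟩⟩
  · simp
  have c0 : (out (v 0)).card ≤ 1 := by
    have := hcard x₀ 0
    rw [hin0, Multiset.card_singleton] at this
    rcases hdeg 0 with h | h <;> omega
  have cl : (out (v (Fin.last _))).card ≤ 1 := by
    have := hcard x₀ (Fin.last _)
    rw [hinl, Multiset.card_singleton] at this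
    rcases hdeg (Fin.last _) with h | h <;> omega
  have cm : ∀ i : Fin k, out (v i.castSucc.succ) = 0 := by
    intro i
    have := hcard x₀ i.castSucc.succ
    rw [hinm, Multiset.card_add, Multiset.card_singleton, Multiset.card_singleton] at this
    rw [← Multiset.card_eq_zero]
    rcases hdeg i.castSucc.succ with h | h
    · omega
    · have := h.1
      simp at this; omega
  obtain ⟨a, ha⟩ := hend _ c0
  obtain ⟨c, hc⟩ := hend _ cl
  have hterm : ∀ x : Fin (k + 1) → Fin n,
      ∏ w, iterD (labels (fun e v => v ∈ ε e) ((Equiv.sumArrowEquivProdArrow _ _ _).symm (x, ℓ)) w) P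
      = ((Matrix.vecMul a (hessian P)) (x 0) * (∏ j : Fin k, hessian P (x j.castSucc) (x j.succ)) *
          ((hessian P).mulVec c) (x (Fin.last k))) *
        ∏ w : {w // w ∉ Set.range v}, iterD (out w) P := by
    intro x
    simp only [hlab]
    rw [hprod, Fin.prod_univ_succ, Fin.prod_univ_castSucc, hin0, Fin.succ_last, hinl, ha, hc]
    congr 1
    rw [← mul_assoc]
    congr 1
    · congr 1
      refine Finset.prod_congr rfl fun i _ => ?_
      rw [hinm, cm, add_zero, iterD_add, iterD_singleton, iterD_singleton]
      rfl
    · rw [Matrix.mulVec, dotProduct]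
      exact Finset.sum_congr rfl fun b _ => by rw [hsymm, mul_comm]
  refine (Finset.sum_congr rfl fun x _ => hterm x).trans ?_
  -- The `k` inner vertices and the two ends together give the exponent `k + 2 = r`.
  rw [← Finset.sum_mul, sum_chain_eq_dotProduct,
    ← Matrix.dotProduct_mulVec, Matrix.mulVec_mulVec, Matrix.mulVec_mulVec, ← pow_succ', ← pow_succ,
    hP, Matrix.zero_mulVec, dotProduct_zero, zero_mul]

end Chain

/-! ### Rooted trees and the derivatives of graph polynomials -/

section Legs

variable {n : ℕ} {K : Type*} [CommRing K] {V W : Type*} [Fintype V] [Fintype W]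

theorem legContract_eq {E : Type*} [Fintype E] [Fintype (E → Fin n)] [DecidableEq V]
    (inc : E → V → Prop) (a : V) (i : Fin n) (P : MvPolynomial (Fin n) K) :
    legContract inc a i P = ∑ ℓ : E → Fin n,
      ∏ v, iterD ((if v = a then {i} else 0) + labels inc ℓ v) P := by
  unfold legContract
  congr!

/-- The polynomial of a graph with an additional leg with label `i` at the vertex `a`. -/
noncomputable def legPoly (G : SimpleGraph V) (a : V) (i : Fin n) (P : MvPolynomial (Fin n) K) :
    MvPolynomial (Fin n) K :=
  letI := Fintype.ofFinite G.edgeSet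
  legContract (edgeInc G) a i P

theorem legPoly_eq (G : SimpleGraph V) [Fintype G.edgeSet] (a : V) (i : Fin n)
    (P : MvPolynomial (Fin n) K) : legPoly G a i P = legContract (edgeInc G) a i P := by
  unfold legPoly
  congr!

theorem pderiv_graphPoly (G : SimpleGraph V) (i : Fin n) (P : MvPolynomial (Fin n) K) :
    pderiv i (graphPoly G P) = ∑ a, legPoly G a i P := by
  let _ := Fintype.ofFinite G.edgeSet
  rw [graphPoly_eq, pderiv_contract]
  exact Finset.sum_congr rfl fun a _ => (legPoly_eq G a i P).symm

theorem legPoly_iso {G : SimpleGraph V} {G' : SimpleGraph W} (f : G ≃g G') (a : V) (i : Fin n)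
    (P : MvPolynomial (Fin n) K) : legPoly G a i P = legPoly G' (f a) i P := by
  classical
  let _ := Fintype.ofFinite G.edgeSet
  let _ := Fintype.ofFinite G'.edgeSet
  rw [legPoly_eq, legPoly_eq, legContract_eq, legContract_eq]
  refine Fintype.sum_equiv (f.mapEdgeSet.arrowCongr (Equiv.refl _)) _ _ fun ℓ => ?_
  refine Fintype.prod_equiv f.toEquiv _ _ fun y => ?_
  rw [labels_congr (inc := edgeInc G) (inc' := edgeInc G') f.mapEdgeSet y (f.toEquiv y) ?_ ℓ
    (f.mapEdgeSet.arrowCongr (Equiv.refl _) ℓ)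
    (fun x => congrArg ℓ (f.mapEdgeSet.symm_apply_apply x).symm)]
  · congr 2
    simp
  · intro x
    simp only [edgeInc]
    rw [show ((f.mapEdgeSet x).1) = Sym2.map f x.1 from rfl, Sym2.mem_map]
    constructor
    · intro h; exact ⟨y, h, rfl⟩
    · rintro ⟨z, hz, h⟩; rwa [← f.toEquiv.injective h]

open Classical in
/-- The children of `v` in a graph with root `ρ`. -/
noncomputable def childSet (G : SimpleGraph V) (ρ v : V) : Finset V :=
  Finset.univ.filter fun w => G.Adj v w ∧ G.dist ρ w = G.dist ρ v + 1

open Classical in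
/-- The polynomial of a rooted tree. -/
noncomputable def rootedPoly (G : SimpleGraph V) (ρ : V) (H : PolyMap n K) (i : Fin n) :
    MvPolynomial (Fin n) K :=
  ∑ ℓ : V → Fin n with ℓ ρ = i, ∏ v, iterD ((childSet G ρ v).val.map ℓ) (H (ℓ v))

/-- The parent is the second vertex of a geodesic from `v` to the root. -/
theorem exists_parent {V : Type*} {G : SimpleGraph V} (hG : G.Connected) {ρ v : V} (hv : v ≠ ρ) :
    ∃ p, G.Adj v p ∧ G.dist ρ v = G.dist ρ p + 1 := by
  obtain ⟨w, hw⟩ := hG.exists_walk_length_eq_dist v ρ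
  cases w with
  | nil => exact absurd rfl hv
  | @cons _ b _ h p =>
    refine ⟨b, h, ?_⟩
    rw [SimpleGraph.Walk.length_cons, SimpleGraph.dist_comm] at hw
    have h1 : G.dist ρ b ≤ p.length := by
      rw [SimpleGraph.dist_comm]; exact SimpleGraph.dist_le p
    have h2 : G.dist ρ v ≤ G.dist ρ b + G.dist b v := hG.dist_triangle
    have h3 : G.dist b v = 1 := SimpleGraph.dist_eq_one_iff_adj.2 h.symm
    omega

/-- Non-root vertices correspond to edges through the edge to the parent, and the root corresponds
to the leg. The derivative along that edge or leg turns `P` into `H (ℓ v)`; the remaining labels at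
`v` are those of its children. -/
theorem legPoly_eq_rootedPoly {G : SimpleGraph V} (hG : G.IsTree) (ρ : V) (i : Fin n)
    {P : MvPolynomial (Fin n) K} {H : PolyMap n K} (hP : ∀ j, pderiv j P = H j) :
    legPoly G ρ i P = rootedPoly G ρ H i := by
  classical
  choose p hp hd using fun v : {v // v ≠ ρ} => exists_parent hG.connected v.2
  -- Two vertices cannot be each other's parent, by distance from the root; surjectivity follows
  -- from the edge count of a tree.
  have hbij : Function.Bijective (fun v : {v // v ≠ ρ} =>
      (⟨s(v.1, p v), G.mem_edgeSet.2 (hp v)⟩ : G.edgeSet)) := by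
    rw [Fintype.bijective_iff_injective_and_card]
    constructor
    · intro v w h
      rcases Sym2.eq_iff.1 (congrArg Subtype.val h) with h | h
      · exact Subtype.ext h.1
      · have h1 := hd v
        have h2 := hd w
        rw [h.2, h.1] at h1
        omega
    · have h1 := hG.card_edgeFinset
      rw [SimpleGraph.edgeFinset_card] at h1
      have h2 : Fintype.card {v // v ≠ ρ} = Fintype.card V - 1 := by
        rw [Fintype.card_subtype_compl, Fintype.card_subtype_eq]
      have : Nonempty V := ⟨ρ⟩
      have h3 : Fintype.card V ≠ 0 := Fintype.card_ne_zero
      change _ = Fintype.card G.edgeSet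
      omega
  set e := Equiv.ofBijective _ hbij with he
  have hmem : ∀ (u : {v // v ≠ ρ}) (v : V), edgeInc G (e u) v ↔ u.1 = v ∨ p u = v := by
    intro u v
    simp [edgeInc, he, eq_comm]
  have hchild : ∀ (u : {v // v ≠ ρ}) (v : V), p u = v ↔ u.1 ∈ childSet G ρ v := by
    intro u v
    simp only [childSet, Finset.mem_filter, Finset.mem_univ, true_and]
    constructor
    · rintro rfl
      exact ⟨(hp u).symm, hd u⟩
    · rintro ⟨h1, h2⟩
      obtain ⟨w, hw⟩ := e.surjective ⟨s(u.1, v), h1.symm⟩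
      rcases Sym2.eq_iff.1 (congrArg Subtype.val hw) with h | h
      · rw [← h.2, Subtype.ext h.1]
      · have := hd w
        rw [h.1, h.2] at this
        omega
  have hρ : ∀ v, ρ ∉ childSet G ρ v := by
    intro v h
    simp [childSet] at h
  have hself : ∀ v, v ∉ childSet G ρ v := by
    intro v h
    simp [childSet] at h
  have hval : ∀ (s : Finset V) (ℓ : V → Fin n), s.val.map ℓ = ∑ u, if u ∈ s then {ℓ u} else 0 := by
    intro s ℓ
    rw [Finset.sum_ite_mem, Finset.univ_inter]
    conv_lhs => rw [← Finset.sum_multiset_singleton s]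
    exact map_sum (Multiset.mapAddMonoidHom ℓ) _ _
  rw [legPoly_eq, legContract_eq, rootedPoly]
  symm
  refine Finset.sum_nbij' (fun ℓ x => ℓ (e.symm x).1)
    (fun m v => if h : v = ρ then i else m (e ⟨v, h⟩)) (by simp) (by simp) ?_ ?_ ?_
  · intro ℓ hℓ
    have hℓ' : ℓ ρ = i := by simpa using hℓ
    funext v
    by_cases hv : v = ρ
    · simp [hv, hℓ']
    · simp [hv]
  · intro m _
    funext x
    simp [(e.symm x).2]
  · intro ℓ hℓ
    have hℓ' : ℓ ρ = i := by simpa using hℓ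
    refine Finset.prod_congr rfl fun v _ => ?_
    rw [← hP, iterD_pderiv]
    congr 1
    have h1 : labels (edgeInc G) (fun x => ℓ (e.symm x).1) v
        = ∑ u : {v // v ≠ ρ}, if u.1 = v ∨ u.1 ∈ childSet G ρ v then {ℓ u.1} else 0 := by
      unfold labels
      rw [← e.sum_comp]
      refine Finset.sum_congr rfl fun u _ => ?_
      simp only [hmem, hchild, Equiv.symm_apply_apply]
    have h2 : (if v = ρ then {i} else 0 : Multiset (Fin n))
        = if ρ = v ∨ ρ ∈ childSet G ρ v then {ℓ ρ} else 0 := by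
      simp [hρ, hℓ', eq_comm]
    rw [h1, h2, ← Fintype.sum_eq_add_sum_subtype_ne
      (fun u => if u = v ∨ u ∈ childSet G ρ v then ({ℓ u} : Multiset (Fin n)) else 0) ρ, hval,
      ← Multiset.singleton_add,
      show ({ℓ v} : Multiset (Fin n)) = ∑ u, if u = v then {ℓ u} else 0 by simp,
      ← Finset.sum_add_distrib]
    refine Finset.sum_congr rfl fun u _ => ?_
    by_cases huv : u = v
    · subst huv; simp [hself]
    · simp [huv]

end Legs

/-! ### Sums over isomorphism classes as sums over labelled trees -/

/-- Orbit-stabilizer: the class of `x` has `|Γ| / |Stab x|` elements, on all of which `f` is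
constant. -/
theorem sum_quotient_stabilizer {Γ X A : Type*} [Group Γ] [Finite Γ] [MulAction Γ X] [Fintype X]
    (s : Setoid X) [Fintype (Quotient s)] (h : ∀ x y, s.r x y ↔ ∃ g : Γ, g • x = y)
    [AddCommGroup A] [Module ℚ A] (f : X → A) (hf : ∀ (g : Γ) x, f (g • x) = f x) :
    ∑ q : Quotient s, (1 / (Nat.card (MulAction.stabilizer Γ q.out) : ℚ)) • f q.out
      = (1 / (Nat.card Γ : ℚ)) • ∑ x, f x := by
  classical
  rw [← Finset.sum_fiberwise (s := Finset.univ) (g := fun x => Quotient.mk s x), Finset.smul_sum]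
  refine Finset.sum_congr rfl fun q _ => ?_
  have hq : ∀ x, Quotient.mk s x = q ↔ x ∈ MulAction.orbit Γ q.out := by
    intro x
    rw [MulAction.mem_orbit_iff, ← h]
    conv_lhs => rw [← Quotient.out_eq q, eq_comm]
    exact Quotient.eq (r := s)
  have h1 : ∀ x ∈ Finset.univ.filter (fun x => Quotient.mk s x = q), f x = f q.out := by
    intro x hx
    obtain ⟨g, rfl⟩ := (hq x).1 (by simpa using hx)
    exact hf g _
  rw [Finset.sum_congr rfl h1, Finset.sum_const, ← Nat.cast_smul_eq_nsmul ℚ, smul_smul]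
  congr 1
  have h2 : (Finset.univ.filter (fun x => Quotient.mk s x = q)).card
      = Nat.card (MulAction.orbit Γ q.out) := by
    rw [Nat.card_eq_fintype_card, Fintype.card_subtype]
    congr 1
    ext x
    simp [hq]
  have h3 := Nat.card_congr (MulAction.orbitProdStabilizerEquivGroup Γ q.out)
  have h4 : (Nat.card (MulAction.stabilizer Γ q.out) : ℚ) ≠ 0 :=
    Nat.cast_ne_zero.2 Nat.card_pos.ne'
  have h5 : (Nat.card Γ : ℚ) ≠ 0 := Nat.cast_ne_zero.2 Nat.card_pos.ne'
  rw [h2]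
  rw [Nat.card_prod] at h3
  rw [div_mul_eq_mul_div, one_mul, div_eq_div_iff h4 h5, one_mul, ← h3, Nat.cast_mul]

/-! ### Relabelling by permutations, and labelled-tree formulas for `nu` and `treeN` -/

section LabelledTrees

variable {n : ℕ} {K : Type*} [CommRing K]

/-- Pulling back along `σ⁻¹` makes `σ` an isomorphism from `G` to `σ • G`, so orbits are isomorphism
classes and stabilizers are automorphism groups. -/
instance permActTree (V : Type*) : MulAction (Equiv.Perm V) {G : SimpleGraph V // G.IsTree} where
  smul σ G := ⟨G.1.comap (σ⁻¹ : Equiv.Perm V),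
    (SimpleGraph.Iso.isTree_iff (SimpleGraph.Iso.comap (σ⁻¹ : Equiv.Perm V) G.1)).2 G.2⟩
  one_smul _ := rfl
  mul_smul σ τ G := by
    refine Subtype.ext ?_
    change G.1.comap _ = (G.1.comap _).comap _
    rw [SimpleGraph.comap_comap, mul_inv_rev]
    rfl

instance permActRooted (V : Type*) :
    MulAction (Equiv.Perm V) {p : SimpleGraph V × V // p.1.IsTree} where
  smul σ p := ⟨(p.1.1.comap (σ⁻¹ : Equiv.Perm V), σ p.1.2),
    (SimpleGraph.Iso.isTree_iff (SimpleGraph.Iso.comap (σ⁻¹ : Equiv.Perm V) p.1.1)).2 p.2⟩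
  one_smul _ := rfl
  mul_smul σ τ p := by
    refine Subtype.ext (Prod.ext ?_ rfl)
    change p.1.1.comap _ = (p.1.1.comap _).comap _
    rw [SimpleGraph.comap_comap, mul_inv_rev]
    rfl

theorem permActTree_eq_iff {V : Type*} (σ : Equiv.Perm V) (G G' : {G : SimpleGraph V // G.IsTree}) :
    σ • G = G' ↔ ∀ a b, G'.1.Adj (σ a) (σ b) ↔ G.1.Adj a b := by
  rw [Subtype.ext_iff]
  change G.1.comap (σ⁻¹ : Equiv.Perm V) = G'.1 ↔ _
  constructor
  · intro h a b
    rw [← h]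
    simp
  · intro h
    ext a b
    rw [SimpleGraph.comap_adj, ← h]
    simp

theorem permActRooted_eq_iff {V : Type*} (σ : Equiv.Perm V)
    (p p' : {p : SimpleGraph V × V // p.1.IsTree}) :
    σ • p = p' ↔ (∀ a b, p'.1.1.Adj (σ a) (σ b) ↔ p.1.1.Adj a b) ∧ σ p.1.2 = p'.1.2 := by
  rw [Subtype.ext_iff, Prod.ext_iff]
  refine and_congr ?_ Iff.rfl
  rw [← permActTree_eq_iff σ ⟨p.1.1, p.2⟩ ⟨p'.1.1, p'.2⟩, Subtype.ext_iff]
  rfl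

/-- The sum of the polynomials of all trees on the vertex set `V`. -/
noncomputable def treeSum (V : Type*) [Fintype V] (P : MvPolynomial (Fin n) K) :
    MvPolynomial (Fin n) K :=
  letI := Fintype.ofFinite {G : SimpleGraph V // G.IsTree}
  ∑ G : {G : SimpleGraph V // G.IsTree}, graphPoly G.1 P

theorem treeSum_eq (V : Type*) [Fintype V] [Fintype {G : SimpleGraph V // G.IsTree}]
    (P : MvPolynomial (Fin n) K) :
    treeSum V P = ∑ G : {G : SimpleGraph V // G.IsTree}, graphPoly G.1 P := by
  unfold treeSum
  congr!

theorem treeSum_congr {V W : Type*} [Fintype V] [Fintype W] (e : V ≃ W)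
    (P : MvPolynomial (Fin n) K) : treeSum V P = treeSum W P := by
  let _ := Fintype.ofFinite {G : SimpleGraph V // G.IsTree}
  let _ := Fintype.ofFinite {G : SimpleGraph W // G.IsTree}
  rw [treeSum_eq, treeSum_eq]
  refine Fintype.sum_equiv (e.simpleGraph.subtypeEquiv fun G =>
    (SimpleGraph.Iso.isTree_iff (SimpleGraph.Iso.comap e.symm G)).symm) _ _ fun G => ?_
  exact graphPoly_iso (SimpleGraph.Iso.comap e.symm G.1).symm P

/-- The vertex that receives the derivative becomes the root. -/
theorem pderiv_treeSum (V : Type*) [Fintype V]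
    [Fintype {p : SimpleGraph V × V // p.1.IsTree}] (i : Fin n) (P : MvPolynomial (Fin n) K) :
    pderiv i (treeSum V P)
      = ∑ p : {p : SimpleGraph V × V // p.1.IsTree}, legPoly p.1.1 p.1.2 i P := by
  let _ := Fintype.ofFinite {G : SimpleGraph V // G.IsTree}
  rw [treeSum_eq, map_sum]
  simp only [pderiv_graphPoly]
  refine (Fintype.sum_prod_type
    (fun x : {G : SimpleGraph V // G.IsTree} × V => legPoly x.1.1 x.2 i P)).symm.trans ?_
  let e : {G : SimpleGraph V // G.IsTree} × V ≃ {p : SimpleGraph V × V // p.1.IsTree} :=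
    { toFun := fun x => ⟨(x.1.1, x.2), x.1.2⟩
      invFun := fun p => (⟨p.1.1, p.2⟩, p.1.2)
      left_inv := fun _ => rfl
      right_inv := fun _ => rfl }
  exact e.sum_comp (fun p => legPoly p.1.1 p.1.2 i P)

variable [Algebra ℚ K]

theorem evalTree_nu (m : ℕ) (P : MvPolynomial (Fin n) K) :
    evalTree P (nu m) = (1 / (m.factorial : ℚ)) • treeSum (Fin m) P := by
  let _ := Fintype.ofFinite {G : SimpleGraph (Fin m) // G.IsTree}
  let _ : Fintype (Quotient (freeTreeSetoid m)) := instFintypeFreeTree m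
  have h := sum_quotient_stabilizer (Γ := Equiv.Perm (Fin m)) (freeTreeSetoid m)
    (h := fun G G' => by
      constructor
      · rintro ⟨f⟩
        exact ⟨f.toEquiv, (permActTree_eq_iff _ _ _).2 fun a b => f.map_rel_iff⟩
      · rintro ⟨σ, hσ⟩
        exact ⟨⟨σ, fun {a b} => (permActTree_eq_iff _ _ _).1 hσ a b⟩⟩)
    (f := fun G => graphPoly G.1 P)
    (hf := fun σ G => graphPoly_iso (SimpleGraph.Iso.comap (σ⁻¹ : Equiv.Perm (Fin m)) G.1) P)
  rw [Nat.card_eq_fintype_card (α := Equiv.Perm (Fin m)), Fintype.card_perm, Fintype.card_fin,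
    ← treeSum_eq] at h
  rw [← h, nu, map_sum]
  refine Finset.sum_congr rfl fun T _ => ?_
  rw [map_smul, evalTree_tree]
  congr 3
  refine Nat.card_congr ?_
  exact
    { toFun := fun f => ⟨f.toEquiv, (permActTree_eq_iff _ _ _).2 fun a b => f.map_rel_iff⟩
      invFun := fun σ => ⟨σ.1, fun {a b} => (permActTree_eq_iff _ _ _).1 σ.2 a b⟩
      left_inv := fun _ => rfl
      right_inv := fun _ => rfl }

theorem treeN_eq (m : ℕ) {P : MvPolynomial (Fin n) K} {H : PolyMap n K}
    (hP : ∀ j, pderiv j P = H j) (i : Fin n) :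
    treeN H m i = (1 / (m.factorial : ℚ)) • pderiv i (treeSum (Fin m) P) := by
  classical
  let _ := Fintype.ofFinite {G : SimpleGraph (Fin m) // G.IsTree}
  let _ := Fintype.ofFinite {p : SimpleGraph (Fin m) × Fin m // p.1.IsTree}
  let _ : Fintype (Quotient (rootedTreeSetoid m)) := instFintypeRootedTree m
  have h := sum_quotient_stabilizer (Γ := Equiv.Perm (Fin m)) (rootedTreeSetoid m)
    (h := fun p p' => by
      constructor
      · rintro ⟨f, hf⟩
        exact ⟨f.toEquiv, (permActRooted_eq_iff _ _ _).2 ⟨fun a b => f.map_rel_iff, hf⟩⟩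
      · rintro ⟨σ, hσ⟩
        have := (permActRooted_eq_iff _ _ _).1 hσ
        exact ⟨⟨σ, fun {a b} => this.1 a b⟩, this.2⟩)
    (f := fun p => legPoly p.1.1 p.1.2 i P)
    (hf := fun σ p => by
      refine (legPoly_iso (SimpleGraph.Iso.comap (σ⁻¹ : Equiv.Perm (Fin m)) p.1.1) _ i P).trans ?_
      congr 1
      exact σ.symm_apply_apply _)
  rw [Nat.card_eq_fintype_card (α := Equiv.Perm (Fin m)), Fintype.card_perm, Fintype.card_fin] at h
  rw [pderiv_treeSum, ← h, treeN]
  refine Finset.sum_congr rfl fun S _ => ?_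
  congr 1
  · refine congrArg _ (congrArg _ (Nat.card_congr ?_))
    exact
      { toFun := fun f => ⟨f.1.toEquiv, (permActRooted_eq_iff _ _ _).2
          ⟨fun a b => f.1.map_rel_iff, f.2⟩⟩
        invFun := fun σ => ⟨⟨σ.1, fun {a b} => ((permActRooted_eq_iff _ _ _).1 σ.2).1 a b⟩,
          ((permActRooted_eq_iff _ _ _).1 σ.2).2⟩
        left_inv := fun _ => rfl
        right_inv := fun _ => rfl }
  · refine Eq.trans ?_ (legPoly_eq_rootedPoly S.isTree S.root i hP).symm
    unfold treePoly rootedPoly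
    congr!

end LabelledTrees

/-! ### Cutting trees at an edge -/

section Cut

variable {V : Type*} {p : V → Prop}

/-- The graph obtained from graphs on `p` and on its complement by adding the edge `ab`. -/
def joinGraph (G₁ : SimpleGraph {x // p x}) (G₂ : SimpleGraph {x // ¬ p x}) (a : {x // p x})
    (b : {x // ¬ p x}) : SimpleGraph V where
  Adj x y := (∃ hx hy, G₁.Adj ⟨x, hx⟩ ⟨y, hy⟩) ∨ (∃ hx hy, G₂.Adj ⟨x, hx⟩ ⟨y, hy⟩) ∨
    (x = a ∧ y = b) ∨ (x = b ∧ y = a)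
  symm := ⟨by
    rintro x y (⟨hx, hy, h⟩ | ⟨hx, hy, h⟩ | h | h)
    · exact Or.inl ⟨hy, hx, h.symm⟩
    · exact Or.inr (Or.inl ⟨hy, hx, h.symm⟩)
    · exact Or.inr (Or.inr (Or.inr h.symm))
    · exact Or.inr (Or.inr (Or.inl h.symm))⟩
  loopless := ⟨by
    rintro x (⟨hx, hy, h⟩ | ⟨hx, hy, h⟩ | h | h)
    · exact h.ne rfl
    · exact h.ne rfl
    · exact b.2 (h.2 ▸ h.1 ▸ a.2)
    · exact b.2 (h.1 ▸ h.2 ▸ a.2)⟩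

section Join

variable {G₁ : SimpleGraph {x // p x}} {G₂ : SimpleGraph {x // ¬ p x}} {a : {x // p x}}
  {b : {x // ¬ p x}}

theorem joinGraph_adj_left (x y : {x // p x}) :
    (joinGraph G₁ G₂ a b).Adj x y ↔ G₁.Adj x y := by
  constructor
  · rintro (⟨hx, hy, h⟩ | ⟨hx, hy, h⟩ | h | h)
    · exact h
    · exact absurd x.2 hx
    · exact absurd (h.2 ▸ y.2) b.2
    · exact absurd (h.1 ▸ x.2) b.2
  · intro h; exact Or.inl ⟨x.2, y.2, h⟩

theorem joinGraph_adj_right (x y : {x // ¬ p x}) :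
    (joinGraph G₁ G₂ a b).Adj x y ↔ G₂.Adj x y := by
  constructor
  · rintro (⟨hx, hy, h⟩ | ⟨hx, hy, h⟩ | h | h)
    · exact absurd hx x.2
    · exact h
    · exact absurd a.2 (h.1 ▸ x.2)
    · exact absurd a.2 (h.2 ▸ y.2)
  · intro h; exact Or.inr (Or.inl ⟨x.2, y.2, h⟩)

theorem joinGraph_adj_cross {x y : V} (hx : p x) (hy : ¬ p y) :
    (joinGraph G₁ G₂ a b).Adj x y ↔ x = a ∧ y = b := by
  constructor
  · rintro (⟨_, h, _⟩ | ⟨h, _, _⟩ | h | h)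
    · exact absurd h hy
    · exact absurd hx h
    · exact h
    · exact absurd (h.1 ▸ hx) b.2
  · intro h; exact Or.inr (Or.inr (Or.inl h))

/-- The edges of a join. -/
def joinEdge (G₁ : SimpleGraph {x // p x}) (G₂ : SimpleGraph {x // ¬ p x}) (a : {x // p x})
    (b : {x // ¬ p x}) : Option (G₁.edgeSet ⊕ G₂.edgeSet) → Sym2 V
  | none => s(a, b)
  | some (.inl e) => Sym2.map Subtype.val e.1
  | some (.inr e) => Sym2.map Subtype.val e.1

theorem joinEdge_injective : Function.Injective (joinEdge G₁ G₂ a b) := by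
  have hmapl : ∀ (z : Sym2 {x // p x}) (x : V), x ∈ Sym2.map Subtype.val z → p x := by
    intro z x hx
    obtain ⟨y, -, rfl⟩ := Sym2.mem_map.1 hx
    exact y.2
  have hmapr : ∀ (z : Sym2 {x // ¬ p x}) (x : V), x ∈ Sym2.map Subtype.val z → ¬ p x := by
    intro z x hx
    obtain ⟨y, -, rfl⟩ := Sym2.mem_map.1 hx
    exact y.2
  have hmem : ∀ {q : V → Prop} (z : Sym2 {x // q x}), ∃ x, x ∈ Sym2.map Subtype.val z := by
    intro q z
    induction z using Sym2.ind with
    | _ x y => exact ⟨x, by simp⟩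
  rintro (_ | e | e) (_ | e' | e') h
  · rfl
  · exact absurd (hmapl e'.1 b (by rw [← show _ = Sym2.map Subtype.val e'.1 from h]; simp [joinEdge])) b.2
  · exact absurd a.2 (hmapr e'.1 a (by rw [← show _ = Sym2.map Subtype.val e'.1 from h]; simp [joinEdge]))
  · exact absurd (hmapl e.1 b (by rw [show Sym2.map Subtype.val e.1 = _ from h]; simp [joinEdge])) b.2
  · rw [Subtype.ext (Sym2.map.injective Subtype.val_injective h)]
  · obtain ⟨x, hx⟩ := hmem e.1
    have hx' : x ∈ Sym2.map Subtype.val e'.1 := by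
      rw [← show Sym2.map Subtype.val e.1 = Sym2.map Subtype.val e'.1 from h]; exact hx
    exact absurd (hmapl _ _ hx) (hmapr _ _ hx')
  · exact absurd a.2 (hmapr e.1 a (by rw [show Sym2.map Subtype.val e.1 = _ from h]; simp [joinEdge]))
  · obtain ⟨x, hx⟩ := hmem e.1
    have hx' : x ∈ Sym2.map Subtype.val e'.1 := by
      rw [← show Sym2.map Subtype.val e.1 = Sym2.map Subtype.val e'.1 from h]; exact hx
    exact absurd (hmapl _ _ hx') (hmapr _ _ hx)
  · rw [Subtype.ext (Sym2.map.injective Subtype.val_injective h)]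

theorem mem_joinGraph_edgeSet (x : Sym2 V) :
    x ∈ (joinGraph G₁ G₂ a b).edgeSet ↔ ∃ e, joinEdge G₁ G₂ a b e = x := by
  constructor
  · induction x using Sym2.ind with
    | _ x y =>
      rintro (⟨hx, hy, h⟩ | ⟨hx, hy, h⟩ | h | h)
      · exact ⟨some (.inl ⟨s(⟨x, hx⟩, ⟨y, hy⟩), h⟩), rfl⟩
      · exact ⟨some (.inr ⟨s(⟨x, hx⟩, ⟨y, hy⟩), h⟩), rfl⟩
      · exact ⟨none, Sym2.eq_iff.2 (Or.inl ⟨h.1.symm, h.2.symm⟩)⟩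
      · exact ⟨none, Sym2.eq_iff.2 (Or.inr ⟨h.2.symm, h.1.symm⟩)⟩
  · rintro ⟨_ | ⟨e, he⟩ | ⟨e, he⟩, rfl⟩
    · exact Or.inr (Or.inr (Or.inl ⟨rfl, rfl⟩))
    · induction e using Sym2.ind with
      | _ x y => exact Or.inl ⟨x.2, y.2, he⟩
    · induction e using Sym2.ind with
      | _ x y => exact Or.inr (Or.inl ⟨x.2, y.2, he⟩)

theorem joinGraph_isTree [Finite V] (h₁ : G₁.IsTree) (h₂ : G₂.IsTree) :
    (joinGraph G₁ G₂ a b).IsTree := by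
  classical
  have := Fintype.ofFinite V
  rw [SimpleGraph.isTree_iff_connected_and_card]
  constructor
  · have hl : ∀ x : {x // p x}, (joinGraph G₁ G₂ a b).Reachable x a := fun x =>
      (h₁.connected.preconnected x a).map
        (⟨Subtype.val, fun {x y} h => (joinGraph_adj_left x y).2 h⟩ : G₁ →g joinGraph G₁ G₂ a b)
    have hr : ∀ x : {x // ¬ p x}, (joinGraph G₁ G₂ a b).Reachable x b := fun x =>
      (h₂.connected.preconnected x b).map
        (⟨Subtype.val, fun {x y} h => (joinGraph_adj_right x y).2 h⟩ : G₂ →g joinGraph G₁ G₂ a b)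
    have hab : (joinGraph G₁ G₂ a b).Reachable b a :=
      (SimpleGraph.Adj.reachable ((joinGraph_adj_cross a.2 b.2).2 ⟨rfl, rfl⟩)).symm
    have hall : ∀ x, (joinGraph G₁ G₂ a b).Reachable x a := by
      intro x
      by_cases hx : p x
      · exact hl ⟨x, hx⟩
      · exact (hr ⟨x, hx⟩).trans hab
    have : Nonempty V := ⟨a⟩
    exact ⟨fun x y => (hall x).trans (hall y).symm⟩
  · have h3 : Nat.card (joinGraph G₁ G₂ a b).edgeSet
        = Nat.card (Option (G₁.edgeSet ⊕ G₂.edgeSet)) := by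
      refine (Nat.card_congr (Equiv.ofBijective
        (fun e => ⟨joinEdge G₁ G₂ a b e, (mem_joinGraph_edgeSet _).2 ⟨e, rfl⟩⟩) ⟨?_, ?_⟩)).symm
      · intro e e' h
        exact joinEdge_injective (congrArg Subtype.val h)
      · rintro ⟨x, hx⟩
        obtain ⟨e, he⟩ := (mem_joinGraph_edgeSet x).1 hx
        exact ⟨e, Subtype.ext he⟩
    have h4 := (SimpleGraph.isTree_iff_connected_and_card.1 h₁).2
    have h5 := (SimpleGraph.isTree_iff_connected_and_card.1 h₂).2
    have h6 : Nat.card V = Nat.card {x // p x} + Nat.card {x // ¬ p x} := by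
      rw [← Nat.card_sum]
      exact Nat.card_congr (Equiv.sumCompl p).symm
    rw [h3, Finite.card_option, Nat.card_sum]
    omega

end Join

/-- Once the label `i` of the new edge is fixed, it is a leg at `a` and a leg at `b`, and all other
edges lie on one side. -/
theorem graphPoly_joinGraph {n : ℕ} {K : Type*} [CommRing K] [Fintype V] [il : Fintype {x // p x}]
    [ir : Fintype {x // ¬ p x}] (G₁ : SimpleGraph {x // p x}) (G₂ : SimpleGraph {x // ¬ p x})
    (a : {x // p x}) (b : {x // ¬ p x}) (P : MvPolynomial (Fin n) K) :
    graphPoly (joinGraph G₁ G₂ a b) P = ∑ i, legPoly G₁ a i P * legPoly G₂ b i P := by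
  classical
  obtain rfl : il = Subtype.fintype p := Subsingleton.elim _ _
  obtain rfl : ir = Subtype.fintype fun x => ¬ p x := Subsingleton.elim _ _
  let _ := Fintype.ofFinite G₁.edgeSet
  let _ := Fintype.ofFinite G₂.edgeSet
  rw [graphPoly_eq_contract _ (joinEdge G₁ G₂ a b) joinEdge_injective mem_joinGraph_edgeSet,
    contract_eq, ← (Equiv.piOptionEquivProd (β := fun _ => Fin n)).symm.sum_comp,
    Fintype.sum_prod_type]
  refine Finset.sum_congr rfl fun i _ => ?_
  rw [legPoly_eq, legPoly_eq, legContract_eq, legContract_eq, Finset.sum_mul_sum,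
    ← (Equiv.sumArrowEquivProdArrow _ _ _).symm.sum_comp, Fintype.sum_prod_type]
  refine Finset.sum_congr rfl fun ℓ _ => Finset.sum_congr rfl fun ℓ' _ => ?_
  have hlab : ∀ v, labels (fun e v => v ∈ joinEdge G₁ G₂ a b e)
      ((Equiv.piOptionEquivProd (β := fun _ => Fin n)).symm
        (i, (Equiv.sumArrowEquivProdArrow _ _ _).symm (ℓ, ℓ'))) v
      = (if v = a.1 ∨ v = b.1 then {i} else 0) +
        (labels (fun (e : G₁.edgeSet) v => v ∈ Sym2.map Subtype.val e.1) ℓ v +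
          labels (fun (e : G₂.edgeSet) v => v ∈ Sym2.map Subtype.val e.1) ℓ' v) := by
    intro v
    rw [labels_option, labels_sum]
    congr 1
    simp [joinEdge]
  simp only [hlab]
  rw [← Fintype.prod_subtype_mul_prod_subtype p]
  refine congrArg₂ _ ?_ ?_
  · refine Fintype.prod_equiv (Equiv.refl _) _ _ fun v => ?_
    congr 2
    · have : (v.1 = a.1 ∨ v.1 = b.1) ↔ v = a := by
        rw [Subtype.ext_iff]
        refine or_iff_left ?_
        intro h
        exact b.2 (h ▸ v.2)
      simp only [this]
      rfl
    · rw [labels_eq_zero (inc := fun (e : G₂.edgeSet) v => v ∈ Sym2.map Subtype.val e.1), add_zero]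
      · refine labels_congr (Equiv.refl _) _ _ (fun e => ?_) _ _ fun _ => rfl
        simp [edgeInc, v.2]
      · intro e he
        obtain ⟨y, -, hy⟩ := Sym2.mem_map.1 he
        exact y.2 (hy ▸ v.2)
  · refine Fintype.prod_equiv (Equiv.refl _) _ _ fun v => ?_
    congr 2
    · have : (v.1 = a.1 ∨ v.1 = b.1) ↔ v = b := by
        rw [Subtype.ext_iff]
        refine or_iff_right ?_
        intro h
        exact v.2 (h ▸ a.2)
      simp only [this]
      rfl
    · rw [labels_eq_zero (inc := fun (e : G₁.edgeSet) v => v ∈ Sym2.map Subtype.val e.1), zero_add]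
      · refine labels_congr (Equiv.refl _) _ _ (fun e => ?_) _ _ fun _ => rfl
        simp [edgeInc, v.2]
      · intro e he
        obtain ⟨y, -, hy⟩ := Sym2.mem_map.1 he
        exact v.2 (hy ▸ y.2)

/-- The edge `ab` of `G` cuts `G` into a tree on `p` and a tree on its complement. -/
structure IsCut (p : V → Prop) (G : SimpleGraph V) (a b : V) : Prop where
  left : p a
  right : ¬ p b
  adj : G.Adj a b
  tree_left : (G.comap (Subtype.val : {x // p x} → V)).IsTree
  tree_right : (G.comap (Subtype.val : {x // ¬ p x} → V)).IsTree
  cross : ∀ x y, p x → ¬ p y → G.Adj x y → x = a ∧ y = b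

theorem isCut_joinGraph {G₁ : SimpleGraph {x // p x}} {G₂ : SimpleGraph {x // ¬ p x}}
    (h₁ : G₁.IsTree) (h₂ : G₂.IsTree) (a : {x // p x}) (b : {x // ¬ p x}) :
    IsCut p (joinGraph G₁ G₂ a b) a b where
  left := a.2
  right := b.2
  adj := (joinGraph_adj_cross a.2 b.2).2 ⟨rfl, rfl⟩
  tree_left := by
    convert h₁
    ext x y
    exact joinGraph_adj_left x y
  tree_right := by
    convert h₂
    ext x y
    exact joinGraph_adj_right x y
  cross x y hx hy h := (joinGraph_adj_cross hx hy).1 h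

theorem IsCut.eq_joinGraph {G : SimpleGraph V} {a b : V} (h : IsCut p G a b) :
    joinGraph (G.comap Subtype.val) (G.comap Subtype.val) ⟨a, h.left⟩ ⟨b, h.right⟩ = G := by
  ext x y
  by_cases hx : p x <;> by_cases hy : p y
  · exact joinGraph_adj_left ⟨x, hx⟩ ⟨y, hy⟩
  · rw [joinGraph_adj_cross hx hy]
    constructor
    · rintro ⟨rfl, rfl⟩; exact h.adj
    · exact h.cross x y hx hy
  · rw [SimpleGraph.adj_comm, joinGraph_adj_cross hy hx, SimpleGraph.adj_comm]
    constructor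
    · rintro ⟨rfl, rfl⟩; exact h.adj
    · exact h.cross y x hy hx
  · exact joinGraph_adj_right ⟨x, hx⟩ ⟨y, hy⟩

theorem IsCut.isTree [Finite V] {G : SimpleGraph V} {a b : V} (h : IsCut p G a b) : G.IsTree := by
  rw [← h.eq_joinGraph]
  exact joinGraph_isTree h.tree_left h.tree_right

/-- Gives uniqueness of the cut: its left side must be the component of `a` after deleting the edge.
-/
theorem IsCut.iff_reachable {G : SimpleGraph V} {a b : V} (h : IsCut p G a b) (x : V) :
    p x ↔ (G.deleteEdges {s(a, b)}).Reachable a x := by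
  constructor
  · intro hx
    exact (h.tree_left.connected.preconnected ⟨a, h.left⟩ ⟨x, hx⟩).map
      (⟨Subtype.val, fun {y z} hyz => by
        rw [SimpleGraph.deleteEdges_adj]
        refine ⟨hyz, ?_⟩
        intro hs
        rcases Sym2.eq_iff.1 hs with h' | h'
        · exact h.right (h'.2 ▸ z.2)
        · exact h.right (h'.1 ▸ y.2)⟩ : G.comap Subtype.val →g G.deleteEdges {s(a, b)})
  · intro hr
    rw [SimpleGraph.reachable_iff_reflTransGen] at hr
    induction hr with
    | refl => exact h.left
    | @tail y z _ hyz ih =>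
      by_contra hz
      rw [SimpleGraph.deleteEdges_adj] at hyz
      obtain ⟨rfl, rfl⟩ := h.cross y z ih hz hyz.1
      exact hyz.2 rfl

theorem isTree_comap_of_reachable {G : SimpleGraph V} (hG : G.IsTree) {H : SimpleGraph V}
    (hH : H ≤ G) {c : V} {q : V → Prop} (hq : ∀ x, q x ↔ H.Reachable c x) :
    (G.comap (Subtype.val : {x // q x} → V)).IsTree := by
  have hc : q c := (hq c).2 (SimpleGraph.Reachable.refl c)
  refine ⟨?_, hG.isAcyclic.of_comap (Function.Embedding.subtype q)⟩
  have key : ∀ x (hx : q x), (G.comap (Subtype.val : {x // q x} → V)).Reachable ⟨c, hc⟩ ⟨x, hx⟩ := by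
    intro x hx
    have hr := (hq x).1 hx
    rw [SimpleGraph.reachable_iff_reflTransGen] at hr
    induction hr with
    | refl => exact SimpleGraph.Reachable.refl _
    | @tail y z hy hyz ih =>
      have hqy : q y := (hq y).2 ((SimpleGraph.reachable_iff_reflTransGen _ _).2 hy)
      refine (ih hqy).trans (SimpleGraph.Adj.reachable ?_)
      exact hH hyz
  have : Nonempty {x // q x} := ⟨⟨c, hc⟩⟩
  exact ⟨fun x y => (key x.1 x.2).symm.trans (key y.1 y.2)⟩

/-- Existence of the cut: every edge of a tree is a bridge. -/
theorem isCut_reachable {G : SimpleGraph V} (hG : G.IsTree) {a b : V} (hab : G.Adj a b) :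
    IsCut (fun x => (G.deleteEdges {s(a, b)}).Reachable a x) G a b := by
  have hb : ¬ (G.deleteEdges {s(a, b)}).Reachable a b :=
    SimpleGraph.isBridge_iff.1 (SimpleGraph.isAcyclic_iff_forall_adj_isBridge.1 hG.isAcyclic hab)
  have hor : ∀ x, (G.deleteEdges {s(a, b)}).Reachable a x ∨
      (G.deleteEdges {s(a, b)}).Reachable b x := by
    intro x
    have hr := hG.connected.preconnected a x
    rw [SimpleGraph.reachable_iff_reflTransGen] at hr
    induction hr with
    | refl => exact Or.inl (SimpleGraph.Reachable.refl _)
    | @tail y z _ hyz ih =>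
      by_cases he : s(y, z) = s(a, b)
      · rcases Sym2.eq_iff.1 he with h | h
        · exact Or.inr (h.2 ▸ SimpleGraph.Reachable.refl _)
        · exact Or.inl (h.2 ▸ SimpleGraph.Reachable.refl _)
      · have : (G.deleteEdges {s(a, b)}).Adj y z := by
          rw [SimpleGraph.deleteEdges_adj]
          exact ⟨hyz, he⟩
        exact ih.imp (fun h => h.trans this.reachable) (fun h => h.trans this.reachable)
  refine ⟨SimpleGraph.Reachable.refl _, hb, hab,
    isTree_comap_of_reachable hG (SimpleGraph.deleteEdges_le _) fun _ => Iff.rfl,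
    isTree_comap_of_reachable hG (SimpleGraph.deleteEdges_le _) (c := b) fun x =>
      ⟨fun h => (hor x).resolve_left h, fun h h' => hb (h'.trans h.symm)⟩, ?_⟩
  intro x y hx hy hxy
  by_cases he : s(x, y) = s(a, b)
  · rcases Sym2.eq_iff.1 he with h | h
    · exact h
    · exact absurd (h.1 ▸ hx) hb
  · refine absurd (hx.trans (SimpleGraph.Adj.reachable ?_)) hy
    rw [SimpleGraph.deleteEdges_adj]
    exact ⟨hxy, he⟩

-- An oriented edge of a tree determines exactly one vertex set `s` as its left side.
open Classical in
theorem sum_isCut [Fintype V] {A : Type*} [AddCommMonoid A] (G : SimpleGraph V) (a b : V) (c : A) :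
    ∑ s : Finset V, (if IsCut (fun x => x ∈ s) G a b then c else 0)
      = if G.IsTree ∧ G.Adj a b then c else 0 := by
  by_cases h : G.IsTree ∧ G.Adj a b
  · rw [if_pos h]
    set s₀ : Finset V := Finset.univ.filter fun x => (G.deleteEdges {s(a, b)}).Reachable a x with hs₀
    rw [Finset.sum_eq_single s₀, if_pos]
    · convert isCut_reachable h.1 h.2 using 2 with x
      simp [hs₀]
    · intro s _ hs
      rw [if_neg]
      intro hc
      refine hs (Finset.ext fun x => ?_)
      rw [hc.iff_reachable x]
      simp [hs₀]
    · simp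
  · rw [if_neg h]
    refine Finset.sum_eq_zero fun s _ => ?_
    rw [if_neg]
    intro hc
    exact h ⟨hc.isTree, hc.adj⟩

end Cut

/-! ### The quadratic recursion for sums over labelled trees -/

section CutSum

variable {n : ℕ} {K : Type*} [CommRing K] {V : Type*} [Fintype V]

/-- Joining the roots of a rooted tree on `p` and one on its complement is inverse to cutting a tree
at an oriented edge that separates these sets. -/
theorem sum_pderiv_treeSum_mul (p : V → Prop) [Fintype {x // p x}] [Fintype {x // ¬ p x}]
    [Fintype {x : SimpleGraph V × V × V // IsCut p x.1 x.2.1 x.2.2}]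
    (P : MvPolynomial (Fin n) K) :
    ∑ i, pderiv i (treeSum {x // p x} P) * pderiv i (treeSum {x // ¬ p x} P)
      = ∑ x : {x : SimpleGraph V × V × V // IsCut p x.1 x.2.1 x.2.2}, graphPoly x.1.1 P := by
  let _ := Fintype.ofFinite {y : SimpleGraph {x // p x} × {x // p x} // y.1.IsTree}
  let _ := Fintype.ofFinite {y : SimpleGraph {x // ¬ p x} × {x // ¬ p x} // y.1.IsTree}
  simp only [pderiv_treeSum, Finset.sum_mul_sum]
  rw [Finset.sum_comm]
  simp only [Finset.sum_comm (s := (Finset.univ : Finset (Fin n))), ← graphPoly_joinGraph]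
  rw [← Fintype.sum_prod_type' (f := fun
    (y : {y : SimpleGraph {x // p x} × {x // p x} // y.1.IsTree})
    (z : {y : SimpleGraph {x // ¬ p x} × {x // ¬ p x} // y.1.IsTree}) =>
    graphPoly (joinGraph y.1.1 z.1.1 y.1.2 z.1.2) P)]
  let e : {y : SimpleGraph {x // p x} × {x // p x} // y.1.IsTree} ×
      {y : SimpleGraph {x // ¬ p x} × {x // ¬ p x} // y.1.IsTree} ≃
      {x : SimpleGraph V × V × V // IsCut p x.1 x.2.1 x.2.2} :=
    { toFun := fun y => ⟨(joinGraph y.1.1.1 y.2.1.1 y.1.1.2 y.2.1.2, y.1.1.2, y.2.1.2),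
        isCut_joinGraph y.1.2 y.2.2 _ _⟩
      invFun := fun x => (⟨(x.1.1.comap Subtype.val, ⟨x.1.2.1, x.2.left⟩), x.2.tree_left⟩,
        ⟨(x.1.1.comap Subtype.val, ⟨x.1.2.2, x.2.right⟩), x.2.tree_right⟩)
      left_inv := by
        rintro ⟨⟨⟨G, a⟩, h⟩, ⟨⟨G', b⟩, h'⟩⟩
        refine Prod.ext (Subtype.ext (Prod.ext ?_ rfl)) (Subtype.ext (Prod.ext ?_ rfl))
        · ext x y
          exact joinGraph_adj_left x y
        · ext x y
          exact joinGraph_adj_right x y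
      right_inv := by
        rintro ⟨⟨G, a, b⟩, h⟩
        exact Subtype.ext (Prod.ext h.eq_joinGraph rfl) }
  exact e.sum_comp (fun x => graphPoly x.1.1 P)

-- Double counting of trees with an oriented edge: there are `2 (|V| - 1)` orientations per tree,
-- and each determines the set `s`.
open Classical in
theorem two_mul_treeSum (V : Type*) [Fintype V] (P : MvPolynomial (Fin n) K) :
    (2 * (Fintype.card V - 1)) • treeSum V P = ∑ s : Finset V,
      ∑ i, pderiv i (treeSum {x // x ∈ s} P) * pderiv i (treeSum {x // x ∉ s} P) := by
  let _ := Fintype.ofFinite (SimpleGraph V)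
  have h1 : ∀ s : Finset V,
      ∑ i, pderiv i (treeSum {x // x ∈ s} P) * pderiv i (treeSum {x // x ∉ s} P)
      = ∑ x : SimpleGraph V × V × V,
        if IsCut (fun y => y ∈ s) x.1 x.2.1 x.2.2 then graphPoly x.1 P else 0 := by
    intro s
    let _ := Fintype.ofFinite
      {x : SimpleGraph V × V × V // IsCut (fun y => y ∈ s) x.1 x.2.1 x.2.2}
    rw [← Finset.sum_filter, sum_pderiv_treeSum_mul (fun y => y ∈ s)]
    symm
    refine Finset.sum_subtype _ (fun x => ?_) _
    simp
  rw [Finset.sum_congr rfl fun s _ => h1 s, Finset.sum_comm]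
  simp only [sum_isCut]
  have h2 : ∀ G : SimpleGraph V,
      ∑ y : V × V, (if G.IsTree ∧ G.Adj y.1 y.2 then graphPoly G P else 0)
      = if G.IsTree then (2 * (Fintype.card V - 1)) • graphPoly G P else 0 := by
    intro G
    by_cases hG : G.IsTree
    · simp only [hG, true_and, if_true]
      rw [Fintype.sum_prod_type]
      have h3 : ∀ a, ∑ b, (if G.Adj a b then graphPoly G P else 0) = G.degree a • graphPoly G P := by
        intro a
        rw [← Finset.sum_filter, Finset.sum_const, ← G.card_neighborFinset_eq_degree,
          G.neighborFinset_eq_filter]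
      simp only [h3]
      rw [← Finset.sum_smul, G.sum_degrees_eq_twice_card_edges, ← hG.card_edgeFinset,
        Nat.add_sub_cancel]
    · simp [hG]
  rw [Fintype.sum_prod_type, Finset.sum_congr rfl fun G _ => h2 G, ← Finset.sum_filter,
    ← Finset.smul_sum, treeSum_eq]
  congr 1
  symm
  refine Finset.sum_subtype _ (fun x => ?_) _
  simp

/-- The recursion for the sums over labelled trees obtained by cutting an edge. -/
theorem two_mul_treeSum_fin (m : ℕ) (P : MvPolynomial (Fin n) K) :
    (2 * (m - 1)) • treeSum (Fin m) P = ∑ k ∈ Finset.range (m + 1),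
      m.choose k • ∑ i, pderiv i (treeSum (Fin k) P) * pderiv i (treeSum (Fin (m - k)) P) := by
  classical
  have h := two_mul_treeSum (Fin m) P
  rw [Fintype.card_fin] at h
  rw [h]
  have h1 : ∀ s : Finset (Fin m),
      ∑ i, pderiv i (treeSum {x // x ∈ s} P) * pderiv i (treeSum {x // x ∉ s} P)
      = ∑ i, pderiv i (treeSum (Fin s.card) P) * pderiv i (treeSum (Fin (m - s.card)) P) := by
    intro s
    rw [treeSum_congr (Fintype.equivFinOfCardEq (Fintype.card_coe s)),
      treeSum_congr (V := {x // x ∉ s}) (W := Fin (m - s.card)) (Fintype.equivFinOfCardEq (by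
        rw [Fintype.card_subtype_compl, Fintype.card_coe, Fintype.card_fin]))]
  have h2 := Finset.sum_powerset_apply_card (x := (Finset.univ : Finset (Fin m))) (fun k => ∑ i, pderiv i (treeSum (Fin k) P) *
    pderiv i (treeSum (Fin (m - k)) P))
  rw [Finset.powerset_univ, Finset.card_univ, Fintype.card_fin] at h2
  rw [← h2]
  refine Finset.sum_congr rfl fun s _ => ?_
  rw [← h1]
  congr!

end CutSum

end

/-! ### Inversion from the inviscid Burgers equation -/

section Inversion

variable {n : ℕ} {K : Type*} [CommRing K]

theorem derivation_aeval {B : Type*} [CommRing B] [Algebra K B] (D : Derivation K B B)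
    (g : Fin n → B) (p : MvPolynomial (Fin n) K) :
    D (MvPolynomial.aeval g p)
      = ∑ i, MvPolynomial.aeval g (MvPolynomial.pderiv i p) * D (g i) := by
  induction p using MvPolynomial.induction_on with
  | C a => simp
  | add p q hp hq => simp only [map_add, hp, hq, add_mul, Finset.sum_add_distrib]
  | mul_X p j hp =>
    simp only [map_mul, MvPolynomial.aeval_X, Derivation.leibniz, hp, smul_eq_mul, map_add,
      MvPolynomial.pderiv_X, add_mul, Finset.sum_add_distrib, Finset.mul_sum]
    congr 1
    · rw [Finset.sum_eq_single j]
      · simp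
      · intro i _ hi; simp [hi.symm]
      · simp
    · exact Finset.sum_congr rfl fun i _ => by ring

/-- The derivation of `A[t]` which applies a derivation of `A` to the coefficients. -/
noncomputable def coeffDer {A : Type*} [CommRing A] [Algebra K A] (d : Derivation K A A) :
    Derivation K (Polynomial A) (Polynomial A) :=
  PolynomialModule.equivPolynomialSelf.compDer d.mapCoeffs

theorem coeff_coeffDer {A : Type*} [CommRing A] [Algebra K A] (d : Derivation K A A)
    (p : Polynomial A) (m : ℕ) : (coeffDer d p).coeff m = d (p.coeff m) := rfl

/-- The derivation `t d/dt` of `A[t]`. -/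
noncomputable def eulerDer (K : Type*) [CommRing K] (A : Type*) [CommRing A] [Algebra K A] :
    Derivation K (Polynomial A) (Polynomial A) :=
  (Polynomial.X : Polynomial A) • (Polynomial.derivative' (R := A)).restrictScalars K

theorem eulerDer_apply {A : Type*} [CommRing A] [Algebra K A] (p : Polynomial A) :
    eulerDer K A p = Polynomial.X * Polynomial.derivative p := rfl

theorem coeff_eulerDer {A : Type*} [CommRing A] [Algebra K A] (p : Polynomial A) (m : ℕ) :
    (eulerDer K A p).coeff m = (m : A) * p.coeff m := by
  rw [eulerDer_apply]
  cases m with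
  | zero => simp
  | succ m => rw [Polynomial.coeff_X_mul, Polynomial.coeff_derivative]; push_cast; ring

/-- The `m`-th coefficient of the left side is `(m - 1)` times that of `E i`. This determines it
from lower ones unless `m = 1`, whence `h1`. -/
theorem eq_zero_of_eulerDer_sub {A ι : Type*} [CommRing A] [Algebra K A] [Algebra ℚ A]
    (E R : ι → Polynomial A) (hE : ∀ i, eulerDer K A (E i) - E i = R i)
    (hR : ∀ m, (∀ k < m, ∀ i, (E i).coeff k = 0) → ∀ i, (R i).coeff m = 0)
    (h1 : ∀ i, (E i).coeff 1 = 0) (i : ι) : E i = 0 := by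
  have key : ∀ m, ∀ i, (E i).coeff m = 0 := by
    intro m
    induction m using Nat.strong_induction_on with
    | _ m ih =>
      intro i
      by_cases hm : m = 1
      · rw [hm, h1]
      have h := congrArg (fun p => Polynomial.coeff p m) (hE i)
      simp only [Polynomial.coeff_sub, coeff_eulerDer, hR m ih] at h
      have h2 : ((m : ℚ) - 1) • (E i).coeff m = 0 := by
        rw [sub_smul, one_smul, ← h, Nat.cast_smul_eq_nsmul, nsmul_eq_mul]
      refine (smul_eq_zero.1 h2).resolve_left (sub_ne_zero.2 ?_)
      exact_mod_cast hm
  exact Polynomial.ext fun m => by rw [key m i, Polynomial.coeff_zero]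

theorem eulerDer_C {A : Type*} [CommRing A] [Algebra K A] (a : A) :
    eulerDer K A (Polynomial.C a) = 0 := by
  rw [eulerDer_apply, Polynomial.derivative_C, mul_zero]

theorem eulerDer_X {A : Type*} [CommRing A] [Algebra K A] :
    eulerDer K A Polynomial.X = Polynomial.X := by
  rw [eulerDer_apply, Polynomial.derivative_X, mul_one]

theorem eulerDer_monomial {A : Type*} [CommRing A] [Algebra K A] (m : ℕ) (a : A) :
    eulerDer K A (Polynomial.monomial m a) = Polynomial.monomial m ((m : A) * a) := by
  refine Polynomial.ext fun k => ?_
  rw [coeff_eulerDer, Polynomial.coeff_monomial, Polynomial.coeff_monomial]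
  split_ifs with h
  · rw [h]
  · rw [mul_zero]

theorem coeffDer_monomial {A : Type*} [CommRing A] [Algebra K A] (d : Derivation K A A) (m : ℕ)
    (a : A) : coeffDer d (Polynomial.monomial m a) = Polynomial.monomial m (d a) := by
  refine Polynomial.ext fun k => ?_
  rw [coeff_coeffDer, Polynomial.coeff_monomial, Polynomial.coeff_monomial]
  split_ifs <;> simp

theorem coeffDer_C {A : Type*} [CommRing A] [Algebra K A] (d : Derivation K A A) (a : A) :
    coeffDer d (Polynomial.C a) = Polynomial.C (d a) :=
  coeffDer_monomial d 0 a

theorem coeffDer_X {A : Type*} [CommRing A] [Algebra K A] (d : Derivation K A A) :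
    coeffDer d Polynomial.X = 0 := by
  rw [← Polynomial.monomial_one_one_eq_X, coeffDer_monomial, Derivation.map_one_eq_zero, map_zero]

/-- Transport along a Burgers flow: if `𝒩` solves Burgers' equation then `t ↦ t p(x + 𝒩)` is
transported by `𝒩`. -/
theorem burgers_transport {B : Type*} [CommRing B] [Algebra K B] (t : B) (θ : Derivation K B B)
    (D : Fin n → Derivation K B B) (x 𝒩 : Fin n → B) (hθt : θ t = t) (hDt : ∀ j, D j t = 0)
    (hθx : ∀ l, θ (x l) = 0) (hDx : ∀ j l, D j (x l) = if l = j then 1 else 0)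
    (h𝒩 : ∀ i, θ (𝒩 i) = 𝒩 i + ∑ j, 𝒩 j * D j (𝒩 i)) (p : MvPolynomial (Fin n) K) :
    θ (t * MvPolynomial.aeval (fun l => x l + 𝒩 l) p)
      = t * MvPolynomial.aeval (fun l => x l + 𝒩 l) p +
        ∑ j, 𝒩 j * D j (t * MvPolynomial.aeval (fun l => x l + 𝒩 l) p) := by
  simp only [Derivation.leibniz, hθt, hDt, smul_eq_mul, mul_zero, add_zero, derivation_aeval,
    map_add, hθx, hDx, h𝒩, zero_add]
  rw [add_comm, mul_comm _ t]
  congr 1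
  simp only [Finset.mul_sum, mul_add, Finset.sum_add_distrib]
  congr 1
  · refine Finset.sum_congr rfl fun l _ => ?_
    rw [Finset.sum_eq_single l]
    · rw [if_pos rfl]; ring
    · intro j _ hj; rw [if_neg hj]; ring
    · simp
  · rw [Finset.sum_comm]
    exact Finset.sum_congr rfl fun j _ => Finset.sum_congr rfl fun l _ => by ring

/-- The polynomial `∑_m N m t^m` in the time variable `t`. -/
noncomputable def timeSeries (N : ℕ → PolyMap n K) (M : ℕ) (i : Fin n) :
    Polynomial (MvPolynomial (Fin n) K) :=
  ∑ m ∈ Finset.range (M + 1), Polynomial.C (N m i) * Polynomial.X ^ m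

theorem coeff_timeSeries {N : ℕ → PolyMap n K} {M : ℕ} (hM : ∀ m, M < m → ∀ i, N m i = 0)
    (i : Fin n) (m : ℕ) : (timeSeries N M i).coeff m = N m i := by
  simp only [timeSeries, Polynomial.finsetSum_coeff, Polynomial.coeff_C_mul_X_pow]
  rw [Finset.sum_ite_eq]
  split_ifs with h
  · rfl
  · rw [hM m (by simpa using h)]

theorem eval_one_timeSeries {N : ℕ → PolyMap n K} (h0 : ∀ i, N 0 i = 0) (M : ℕ) (i : Fin n) :
    (timeSeries N M i).eval 1 = ∑ m ∈ Finset.Icc 1 M, N m i := by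
  simp only [timeSeries, Polynomial.eval_finsetSum, Polynomial.eval_mul, Polynomial.eval_C,
    Polynomial.eval_pow, Polynomial.eval_X, one_pow, mul_one]
  rw [Finset.range_eq_Ico, ← Finset.sum_Ioo_add_eq_sum_Ico (Nat.succ_pos M), h0, add_zero]
  exact Finset.sum_congr (by ext; simp; omega) fun _ _ => rfl

theorem eulerDer_timeSeries {N : ℕ → PolyMap n K} {M : ℕ} (hM : ∀ m, M < m → ∀ i, N m i = 0)
    (hN : ∀ (m : ℕ) (i : Fin n), (m : MvPolynomial (Fin n) K) * N m i - N m i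
      = ∑ x ∈ Finset.HasAntidiagonal.antidiagonal m, ∑ j, N x.1 j * MvPolynomial.pderiv j (N x.2 i)) (i : Fin n) :
    eulerDer K _ (timeSeries N M i) = timeSeries N M i +
      ∑ j, timeSeries N M j * coeffDer (MvPolynomial.pderiv j) (timeSeries N M i) := by
  rw [← sub_eq_iff_eq_add']
  refine Polynomial.ext fun m => ?_
  rw [Polynomial.coeff_sub, coeff_eulerDer, coeff_timeSeries hM, hN, Polynomial.finsetSum_coeff,
    Finset.sum_comm]
  refine Finset.sum_congr rfl fun j _ => ?_
  rw [Polynomial.coeff_mul]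
  refine Finset.sum_congr rfl fun x _ => ?_
  rw [coeff_timeSeries hM, coeff_coeffDer, coeff_timeSeries hM]

theorem eval_aeval {A : Type*} [CommRing A] [Algebra K A] (c : A) (g : Fin n → Polynomial A)
    (p : MvPolynomial (Fin n) K) :
    (MvPolynomial.aeval g p).eval c = MvPolynomial.aeval (fun l => (g l).eval c) p := by
  have h := MvPolynomial.comp_aeval_apply (f := g)
    ((Polynomial.aeval (R := A) c).restrictScalars K) p
  simpa [Polynomial.coe_aeval_eq_eval] using h

/-- Both `𝒩` and `t H(X + 𝒩)` solve the same linear transport equation with velocity `𝒩`. Their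
difference vanishes by induction on powers of `t`; then put `t = 1`. -/
theorem bind₁_timeSeries [Algebra ℚ K] {H : PolyMap n K} {N : ℕ → PolyMap n K} {M : ℕ} (h0 : ∀ i, N 0 i = 0)
    (h1 : ∀ i, N 1 i = H i) (hM : ∀ m, M < m → ∀ i, N m i = 0)
    (hN : ∀ (m : ℕ) (i : Fin n), (m : MvPolynomial (Fin n) K) * N m i - N m i
      = ∑ x ∈ Finset.HasAntidiagonal.antidiagonal m, ∑ j, N x.1 j * MvPolynomial.pderiv j (N x.2 i)) (i : Fin n) :
    MvPolynomial.bind₁ (fun i => MvPolynomial.X i + ∑ m ∈ Finset.Icc 1 M, N m i) (H i)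
      = ∑ m ∈ Finset.Icc 1 M, N m i := by
  set G : Fin n → Polynomial (MvPolynomial (Fin n) K) :=
    fun l => Polynomial.C (MvPolynomial.X l) + timeSeries N M l with hG
  have hV : ∀ i, eulerDer K _ (Polynomial.X * MvPolynomial.aeval G (H i))
      = Polynomial.X * MvPolynomial.aeval G (H i) + ∑ j, timeSeries N M j *
        coeffDer (MvPolynomial.pderiv j) (Polynomial.X * MvPolynomial.aeval G (H i)) := fun i =>
    burgers_transport Polynomial.X (eulerDer K _) (fun j => coeffDer (MvPolynomial.pderiv j)) _ _
      eulerDer_X (fun j => coeffDer_X _) (fun l => eulerDer_C _) (fun j l => by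
        rw [coeffDer_C, MvPolynomial.pderiv_X, Pi.single_apply]
        simp only [eq_comm]
        split_ifs <;> simp) (eulerDer_timeSeries hM hN) (H i)
  have hE : ∀ i, timeSeries N M i - Polynomial.X * MvPolynomial.aeval G (H i) = 0 := by
    refine eq_zero_of_eulerDer_sub (K := K) _
      (fun i => ∑ j, timeSeries N M j * coeffDer (MvPolynomial.pderiv j)
        (timeSeries N M i - Polynomial.X * MvPolynomial.aeval G (H i))) ?_ ?_ ?_
    · intro i
      rw [map_sub, eulerDer_timeSeries hM hN, hV]
      simp only [map_sub, mul_sub, Finset.sum_sub_distrib]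
      ring
    · intro m hm i
      rw [Polynomial.finsetSum_coeff]
      refine Finset.sum_eq_zero fun j _ => ?_
      rw [Polynomial.coeff_mul]
      refine Finset.sum_eq_zero fun x hx => ?_
      rw [Finset.HasAntidiagonal.mem_antidiagonal] at hx
      -- The velocity has no constant term in `t`, so only strictly lower coefficients of the
      -- difference occur.
      rcases Nat.eq_zero_or_pos x.1 with h | h
      · rw [h, coeff_timeSeries hM, h0, zero_mul]
      · rw [coeff_coeffDer, hm x.2 (by omega), map_zero, mul_zero]
    · intro i
      rw [Polynomial.coeff_sub, coeff_timeSeries hM, h1, Polynomial.coeff_X_mul,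
        Polynomial.coeff_zero_eq_eval_zero, eval_aeval, sub_eq_zero]
      have : (fun l => (G l).eval 0) = MvPolynomial.X := by
        funext l
        rw [hG, Polynomial.eval_add, Polynomial.eval_C, ← Polynomial.coeff_zero_eq_eval_zero,
          coeff_timeSeries hM, h0, add_zero]
      rw [this, MvPolynomial.aeval_X_left_apply]
  have h := congrArg (Polynomial.eval 1) (hE i)
  rw [Polynomial.eval_sub, Polynomial.eval_zero, eval_one_timeSeries h0, Polynomial.eval_mul,
    Polynomial.eval_X, one_mul, eval_aeval, sub_eq_zero] at h
  rw [h]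
  change MvPolynomial.aeval _ _ = _
  congr 2
  funext l
  rw [hG, Polynomial.eval_add, Polynomial.eval_C, eval_one_timeSeries h0]

/-- Substitution of `X - t H` into the coefficients of a polynomial in `t`. -/
noncomputable def timeSubst (H : PolyMap n K) :
    Polynomial (MvPolynomial (Fin n) K) →+* Polynomial (MvPolynomial (Fin n) K) :=
  Polynomial.eval₂RingHom (MvPolynomial.aeval (R := K) fun l =>
    Polynomial.C (MvPolynomial.X l) - Polynomial.X * Polynomial.C (H l)).toRingHom Polynomial.X

theorem timeSubst_monomial (H : PolyMap n K) (m : ℕ) (p : MvPolynomial (Fin n) K) :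
    timeSubst H (Polynomial.monomial m p) = MvPolynomial.aeval (fun l =>
      Polynomial.C (MvPolynomial.X l) - Polynomial.X * Polynomial.C (H l)) p *
        Polynomial.X ^ m :=
  Polynomial.eval₂_monomial _ _

theorem timeSubst_X (H : PolyMap n K) : timeSubst H Polynomial.X = Polynomial.X :=
  Polynomial.eval₂_X _ _

/-- The chain rule, where `t d/dt` sends `X l - t H l` to `-t H l`. -/
theorem eulerDer_timeSubst (H : PolyMap n K) (p : Polynomial (MvPolynomial (Fin n) K)) :
    eulerDer K _ (timeSubst H p) = timeSubst H (eulerDer K _ p) -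
      ∑ l, timeSubst H (coeffDer (MvPolynomial.pderiv l) p) *
        (Polynomial.X * Polynomial.C (H l)) := by
  induction p using Polynomial.induction_on' with
  | add p q hp hq =>
    simp only [map_add, hp, hq, add_mul, Finset.sum_add_distrib]
    ring
  | monomial m p =>
    have h1 : ∀ l, eulerDer K _ (Polynomial.C (MvPolynomial.X l) -
        Polynomial.X * Polynomial.C (H l)) = -(Polynomial.X * Polynomial.C (H l)) := by
      intro l
      rw [map_sub, Derivation.leibniz, eulerDer_C, eulerDer_C, eulerDer_X, smul_zero, zero_add,
        zero_sub, smul_eq_mul, mul_comm]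
    have h2 : eulerDer K (MvPolynomial (Fin n) K) (Polynomial.X ^ m)
        = (m : Polynomial _) * Polynomial.X ^ m := by
      rw [← Polynomial.monomial_one_right_eq_X_pow, eulerDer_monomial, mul_one,
        Polynomial.monomial_one_right_eq_X_pow, ← Polynomial.C_mul_X_pow_eq_monomial, map_natCast]
    rw [eulerDer_monomial, timeSubst_monomial, timeSubst_monomial, Derivation.leibniz, h2,
      derivation_aeval]
    simp only [h1, coeffDer_monomial, timeSubst_monomial, map_mul, map_natCast, smul_eq_mul,
      Finset.mul_sum]
    rw [sub_eq_add_neg, ← Finset.sum_neg_distrib]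
    refine congrArg₂ (· + ·) ?_ ?_
    · ring
    · exact Finset.sum_congr rfl fun l _ => by ring

theorem coeff_zero_timeSubst (H : PolyMap n K) (p : Polynomial (MvPolynomial (Fin n) K)) :
    (timeSubst H p).coeff 0 = p.coeff 0 := by
  induction p using Polynomial.induction_on' with
  | add p q hp hq => rw [map_add, Polynomial.coeff_add, hp, hq, Polynomial.coeff_add]
  | monomial m p =>
    rw [timeSubst_monomial, Polynomial.coeff_monomial]
    cases m with
    | zero =>
      rw [pow_zero, mul_one, Polynomial.coeff_zero_eq_eval_zero, eval_aeval, if_pos rfl]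
      simp
    | succ m => simp

theorem eval_one_timeSubst (H : PolyMap n K) (p : Polynomial (MvPolynomial (Fin n) K)) :
    (timeSubst H p).eval 1
      = MvPolynomial.bind₁ (fun l => MvPolynomial.X l - H l) (p.eval 1) := by
  induction p using Polynomial.induction_on' with
  | add p q hp hq => simp only [map_add, Polynomial.eval_add, hp, hq]
  | monomial m p =>
    rw [timeSubst_monomial, Polynomial.eval_mul, eval_aeval]
    rw [Polynomial.eval_monomial, Polynomial.eval_pow, Polynomial.eval_X, one_pow, mul_one, mul_one]
    change _ = MvPolynomial.aeval _ p
    congr 2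
    funext l
    simp

/-- Along the characteristic `X - tH`, the error `U = 𝒩(X - tH) - tH` satisfies the linear equation
`t dU/dt - U = ∑_j (D_j 𝒩)(X - tH) U_j`, hence vanishes; then put `t = 1`. -/
theorem bind₁_sum_timeSeries [Algebra ℚ K] {H : PolyMap n K} {N : ℕ → PolyMap n K} {M : ℕ}
    (h0 : ∀ i, N 0 i = 0) (h1 : ∀ i, N 1 i = H i) (hM : ∀ m, M < m → ∀ i, N m i = 0)
    (hN : ∀ (m : ℕ) (i : Fin n), (m : MvPolynomial (Fin n) K) * N m i - N m i
      = ∑ x ∈ Finset.HasAntidiagonal.antidiagonal m, ∑ j, N x.1 j * MvPolynomial.pderiv j (N x.2 i)) (i : Fin n) :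
    MvPolynomial.bind₁ (fun i => MvPolynomial.X i - H i) (∑ m ∈ Finset.Icc 1 M, N m i) = H i := by
  have hU : ∀ i, timeSubst H (timeSeries N M i) - Polynomial.X * Polynomial.C (H i) = 0 := by
    refine eq_zero_of_eulerDer_sub (K := K) _
      (fun i => ∑ j, timeSubst H (coeffDer (MvPolynomial.pderiv j) (timeSeries N M i)) *
        (timeSubst H (timeSeries N M j) - Polynomial.X * Polynomial.C (H j))) ?_ ?_ ?_
    · intro i
      have h2 : eulerDer K _ (Polynomial.X * Polynomial.C (H i))
          = Polynomial.X * Polynomial.C (H i) := by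
        rw [Derivation.leibniz, eulerDer_C, eulerDer_X, smul_zero, zero_add, smul_eq_mul, mul_comm]
      rw [map_sub, h2, eulerDer_timeSubst, eulerDer_timeSeries hM hN]
      simp only [map_add, map_sum, map_mul, mul_sub, Finset.sum_sub_distrib,
        mul_comm (timeSubst H (timeSeries N M _))]
      ring
    · intro m hm i
      rw [Polynomial.finsetSum_coeff]
      refine Finset.sum_eq_zero fun j _ => ?_
      rw [Polynomial.coeff_mul]
      refine Finset.sum_eq_zero fun x hx => ?_
      rw [Finset.HasAntidiagonal.mem_antidiagonal] at hx
      rcases Nat.eq_zero_or_pos x.1 with h | h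
      · rw [h, coeff_zero_timeSubst, coeff_coeffDer, coeff_timeSeries hM, h0, map_zero, zero_mul]
      · rw [hm x.2 (by omega), mul_zero]
    · intro i
      have h2 : timeSeries N M i = Polynomial.X * (timeSeries N M i).divX := by
        conv_lhs => rw [← Polynomial.X_mul_divX_add (timeSeries N M i)]
        rw [coeff_timeSeries hM, h0, Polynomial.C_0, add_zero]
      rw [h2, map_mul, timeSubst_X, Polynomial.coeff_sub, Polynomial.coeff_X_mul,
        coeff_zero_timeSubst, Polynomial.coeff_divX, coeff_timeSeries hM, h1,
        Polynomial.coeff_X_mul, Polynomial.coeff_C_zero, sub_self]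
  have h := congrArg (Polynomial.eval 1) (hU i)
  rwa [Polynomial.eval_sub, Polynomial.eval_zero, eval_one_timeSubst, eval_one_timeSeries h0,
    Polynomial.eval_mul, Polynomial.eval_X, one_mul, Polynomial.eval_C, sub_eq_zero] at h

/-- Solutions of the inviscid Burgers equation which are polynomial in time yield inverses. -/
theorem isInverse_of_burgers [Algebra ℚ K] {F H : PolyMap n K} (hF : ∀ i, F i = MvPolynomial.X i - H i)
    {N : ℕ → PolyMap n K} {M : ℕ} (h0 : ∀ i, N 0 i = 0) (h1 : ∀ i, N 1 i = H i)
    (hM : ∀ m, M < m → ∀ i, N m i = 0)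
    (hN : ∀ (m : ℕ) (i : Fin n), (m : MvPolynomial (Fin n) K) * N m i - N m i
      = ∑ x ∈ Finset.HasAntidiagonal.antidiagonal m, ∑ j, N x.1 j * MvPolynomial.pderiv j (N x.2 i)) :
    IsInverse F (fun i => MvPolynomial.X i + ∑ m ∈ Finset.Icc 1 M, N m i) := by
  obtain rfl : F = fun i => MvPolynomial.X i - H i := funext hF
  constructor
  · intro i
    rw [map_sub, MvPolynomial.bind₁_X_right, bind₁_timeSeries h0 h1 hM hN, add_sub_cancel_right]
  · intro i
    rw [map_add, MvPolynomial.bind₁_X_right, bind₁_sum_timeSeries h0 h1 hM hN, sub_add_cancel]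

end Inversion

section

open MvPolynomial

/-! ### The tree expansion of the inverse -/

section Expansion

variable {n : ℕ} {K : Type*} [CommRing K]

theorem treeSum_fin_zero (P : MvPolynomial (Fin n) K) : treeSum (Fin 0) P = 0 := by
  let _ := Fintype.ofFinite {G : SimpleGraph (Fin 0) // G.IsTree}
  have : IsEmpty {G : SimpleGraph (Fin 0) // G.IsTree} :=
    ⟨fun G => by obtain ⟨x⟩ := G.2.connected.nonempty; exact x.elim0⟩
  rw [treeSum_eq, Fintype.sum_empty]

theorem treeSum_fin_one (P : MvPolynomial (Fin n) K) : treeSum (Fin 1) P = P := by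
  classical
  let _ := Fintype.ofFinite {G : SimpleGraph (Fin 1) // G.IsTree}
  have hall : ∀ G : SimpleGraph (Fin 1), G = ⊥ := by
    intro G
    ext a b
    rw [Subsingleton.elim a b]
    simp
  let _ : Unique {G : SimpleGraph (Fin 1) // G.IsTree} :=
    { default := ⟨⊥, SimpleGraph.IsTree.of_subsingleton⟩
      uniq := fun G => Subtype.ext (hall G.1) }
  rw [treeSum_eq, Fintype.sum_unique, graphPoly_eq_contract (E := Empty) _ Empty.elim
    (fun e => e.elim), contract_eq]
  · rw [Fintype.sum_unique, Fintype.prod_unique, labels_eq_zero (fun e => e.elim), iterD_zero]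
  · intro x
    rw [hall (default : {G : SimpleGraph (Fin 1) // G.IsTree}).1]
    simp

variable [Algebra ℚ K]

/-- Dividing by `m!` absorbs the binomials in `two_mul_treeSum_fin`. Differentiating gives two sums
exchanged by swapping `k` and `l`, which cancels the 2, and `D_i D_j = D_j D_i` gives Burgers form.
-/
theorem nsmul_treeN {P : MvPolynomial (Fin n) K} {H : PolyMap n K}
    (hP : ∀ j, pderiv j P = H j) (m : ℕ) (i : Fin n) :
    (m : MvPolynomial (Fin n) K) * treeN H m i - treeN H m i
      = ∑ x ∈ Finset.HasAntidiagonal.antidiagonal m,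
        ∑ j, treeN H x.1 j * pderiv j (treeN H x.2 i) := by
  set Q : ℕ → MvPolynomial (Fin n) K := fun m => (1 / (m.factorial : ℚ)) • treeSum (Fin m) P
    with hQ
  have hN : ∀ m i, treeN H m i = pderiv i (Q m) := by
    intro m i
    rw [treeN_eq m hP, hQ]
    exact (map_rat_smul (pderiv (R := K) i) _ _).symm
  have hQ0 : Q 0 = 0 := by simp only [hQ, treeSum_fin_zero, smul_zero]
  obtain rfl | hm := Nat.eq_zero_or_pos m
  -- Separate case, because the recursion for tree sums has truncated `m - 1`.
  · simp [hN, hQ0]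
  have h1 : ((2 : ℚ) * ((m : ℚ) - 1)) • Q m
      = ∑ x ∈ Finset.HasAntidiagonal.antidiagonal m, ∑ j, pderiv j (Q x.1) * pderiv j (Q x.2) := by
    have h2 := two_mul_treeSum_fin m P
    have h3 : ((2 * (m - 1) : ℕ) : ℚ) = 2 * ((m : ℚ) - 1) := by
      push_cast [Nat.cast_sub hm]; ring
    rw [← Nat.cast_smul_eq_nsmul ℚ, h3] at h2
    rw [hQ]
    simp only
    rw [smul_comm, h2, Finset.smul_sum, Finset.Nat.sum_antidiagonal_eq_sum_range_succ_mk]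
    refine Finset.sum_congr rfl fun k hk => ?_
    have hk' : k ≤ m := Nat.lt_succ_iff.1 (Finset.mem_range.1 hk)
    have h4 : (1 / (m.factorial : ℚ)) * (m.choose k : ℚ)
        = (1 / (k.factorial : ℚ)) * (1 / ((m - k).factorial : ℚ)) := by
      rw [Nat.cast_choose ℚ hk']
      have := Nat.factorial_ne_zero m
      field_simp
    rw [← Nat.cast_smul_eq_nsmul ℚ, smul_smul, h4, Finset.smul_sum]
    refine Finset.sum_congr rfl fun j _ => ?_
    rw [map_rat_smul (pderiv (R := K) j), map_rat_smul (pderiv (R := K) j), smul_mul_smul_comm]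
  have h5 := congrArg (pderiv i) h1
  rw [map_rat_smul (pderiv (R := K) i), ← hN, map_sum] at h5
  simp only [map_sum, Derivation.leibniz, smul_eq_mul, Finset.sum_add_distrib] at h5
  have h6 : ∑ x ∈ Finset.HasAntidiagonal.antidiagonal m,
      ∑ j, pderiv j (Q x.2) * pderiv i (pderiv j (Q x.1))
      = ∑ x ∈ Finset.HasAntidiagonal.antidiagonal m,
        ∑ j, pderiv j (Q x.1) * pderiv i (pderiv j (Q x.2)) :=
    Finset.sum_nbij' Prod.swap Prod.swap (by simp [add_comm]) (by simp [add_comm])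
      (by simp) (by simp) (by simp)
  rw [h6, ← two_mul, mul_smul, ofNat_smul_eq_nsmul ℚ, nsmul_eq_mul] at h5
  have h7 : ((m : ℚ) - 1) • treeN H m i = (m : MvPolynomial (Fin n) K) * treeN H m i - treeN H m i := by
    rw [sub_smul, one_smul, Nat.cast_smul_eq_nsmul, nsmul_eq_mul]
  rw [← h7]
  have h8 : IsUnit (2 : MvPolynomial (Fin n) K) := by
    have := (isUnit_iff_ne_zero.2 (two_ne_zero (α := ℚ))).map
      (algebraMap ℚ (MvPolynomial (Fin n) K))
    rwa [map_ofNat] at this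
  rw [Nat.cast_ofNat] at h5
  rw [h8.mul_left_cancel h5]
  simp only [hN, pderiv_comm i]

theorem treeN_zero {P : MvPolynomial (Fin n) K} {H : PolyMap n K}
    (hP : ∀ j, pderiv j P = H j) (i : Fin n) : treeN H 0 i = 0 := by
  rw [treeN_eq 0 hP, treeSum_fin_zero, map_zero, smul_zero]

theorem treeN_one {P : MvPolynomial (Fin n) K} {H : PolyMap n K}
    (hP : ∀ j, pderiv j P = H j) (i : Fin n) : treeN H 1 i = H i := by
  rw [treeN_eq 1 hP, treeSum_fin_one, hP]
  simp

theorem smul_treeN {P : MvPolynomial (Fin n) K} {H : PolyMap n K}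
    (hP : ∀ j, pderiv j P = H j) (m : ℕ) (i : Fin n) : ((m : ℚ) - 1) • treeN H m i
      = ∑ x ∈ Finset.HasAntidiagonal.antidiagonal m,
        ∑ j, treeN H x.1 j * pderiv j (treeN H x.2 i) := by
  rw [← nsmul_treeN hP, sub_smul, one_smul, Nat.cast_smul_eq_nsmul, nsmul_eq_mul]

/-- The gap theorem: the terms of the tree expansion vanish once they vanish from `M + 1`
to `2 M`. -/
theorem treeN_eq_zero_of_gap {P : MvPolynomial (Fin n) K} {H : PolyMap n K}
    (hP : ∀ j, pderiv j P = H j) {M : ℕ} (hM : 0 < M)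
    (hgap : ∀ m, M + 1 ≤ m → m ≤ 2 * M → ∀ i, treeN H m i = 0) (m : ℕ) (hm : M < m) (i : Fin n) :
    treeN H m i = 0 := by
  induction m using Nat.strong_induction_on generalizing i with
  | _ m ih =>
    by_cases h : m ≤ 2 * M
    · exact hgap m hm h i
    have h1 := smul_treeN hP m i
    rw [Finset.sum_eq_zero] at h1
    · refine (smul_eq_zero.1 h1).resolve_left (sub_ne_zero.2 ?_)
      have : m ≠ 1 := by omega
      exact_mod_cast this
    · intro x hx
      rw [Finset.HasAntidiagonal.mem_antidiagonal] at hx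
      refine Finset.sum_eq_zero fun j _ => ?_
      obtain h2 | h2 := Nat.eq_zero_or_pos x.1
      · rw [h2, treeN_zero hP, zero_mul]
      obtain h3 | h3 := Nat.eq_zero_or_pos x.2
      · rw [h3, treeN_zero hP, map_zero, mul_zero]
      -- Both indices are positive and sum to more than `2 M`, so one lies strictly between `M` and
      -- `m`.
      by_cases h4 : M < x.1
      · rw [ih x.1 (by omega) h4, zero_mul]
      · rw [ih x.2 (by omega) (by omega), map_zero, mul_zero]

/-- The recursion preserves these degrees: `(2k + 1) + (2l + 1) - 1 = 2(k + l) + 1`. -/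
theorem treeN_isHomogeneous {P : MvPolynomial (Fin n) K} {H : PolyMap n K}
    (hP : ∀ j, pderiv j P = H j) (hH : ∀ i, (H i).IsHomogeneous 3) (m : ℕ) (i : Fin n) :
    (treeN H m i).IsHomogeneous (2 * m + 1) := by
  induction m using Nat.strong_induction_on generalizing i with
  | _ m ih =>
    by_cases hm : m = 1
    · subst hm
      rw [treeN_one hP]
      exact hH i
    have h1 := smul_treeN hP m i
    have hne : ((m : ℚ) - 1) ≠ 0 := by
      rw [sub_ne_zero]
      exact_mod_cast hm
    have h2 : treeN H m i = algebraMap ℚ (MvPolynomial (Fin n) K) ((m : ℚ) - 1)⁻¹ *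
        ∑ x ∈ Finset.HasAntidiagonal.antidiagonal m,
        ∑ j, treeN H x.1 j * pderiv j (treeN H x.2 i) := by
      rw [← h1, ← Algebra.smul_def, smul_smul, inv_mul_cancel₀ hne, one_smul]
    rw [h2, IsScalarTower.algebraMap_apply ℚ K (MvPolynomial (Fin n) K)]
    refine IsHomogeneous.C_mul ?_ _
    refine IsHomogeneous.sum _ _ _ fun x hx => IsHomogeneous.sum _ _ _ fun j _ => ?_
    rw [Finset.HasAntidiagonal.mem_antidiagonal] at hx
    obtain h2 | h2 := Nat.eq_zero_or_pos x.1
    · rw [h2, treeN_zero hP, zero_mul]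
      exact isHomogeneous_zero _ _ _
    obtain h3 | h3 := Nat.eq_zero_or_pos x.2
    · rw [h3, treeN_zero hP, map_zero, mul_zero]
      exact isHomogeneous_zero _ _ _
    have h4 := (ih x.1 (by omega) j).mul ((ih x.2 (by omega) i).pderiv (i := j))
    convert h4 using 1
    omega

theorem exists_potential {H : PolyMap n K} (hH : ∀ i, (H i).IsHomogeneous 3)
    (hs : (jacobian H).IsSymm) : ∃ P : MvPolynomial (Fin n) K, P.IsHomogeneous 4 ∧
      ∀ j, pderiv j P = H j := by
  -- By symmetry and Euler's identity, the `j`-th derivative of the sum is `H j + 3 H j`.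
  refine ⟨C (algebraMap ℚ K (1 / 4)) * ∑ i, X i * H i, ?_, ?_⟩
  · refine IsHomogeneous.C_mul (IsHomogeneous.sum _ _ _ fun i _ => ?_) _
    exact (isHomogeneous_X K i).mul (hH i)
  · intro j
    have h1 : ∀ i, pderiv j (H i) = pderiv i (H j) := fun i => hs.apply i j
    rw [pderiv_C_mul, map_sum]
    simp only [Derivation.leibniz, smul_eq_mul, Finset.sum_add_distrib, h1]
    rw [(hH j).sum_X_mul_pderiv, Finset.sum_eq_single j]
    · rw [pderiv_X_self, mul_one, ← succ_nsmul, nsmul_eq_mul, ← map_natCast (C (σ := Fin n)),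
        ← mul_assoc, ← C_mul, ← map_natCast (algebraMap ℚ K), ← map_mul]
      norm_num
    · intro i _ hi
      rw [pderiv_X_of_ne hi, mul_zero]
    · simp

end Expansion

/-! ### Vanishing of the relations under evaluation -/

section Relations

variable {n : ℕ} {K : Type*} [CommRing K] [Algebra ℚ K]

theorem relSub_le_ker_evalTree {r : ℕ} (hr : 0 < r) {H : PolyMap n K}
    (hH : ∀ i, (H i).IsHomogeneous 3) (hnil : jacobian H ^ r = 0) {P : MvPolynomial (Fin n) K}
    (hP4 : P.IsHomogeneous 4) (hP : ∀ j, pderiv j P = H j) :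
    relSub r 4 ≤ LinearMap.ker (evalTree P) := by
  have hhess : hessian P = jacobian H := by
    ext1 i j
    change pderiv i (pderiv j P) = pderiv i (H j)
    rw [hP]
  refine sup_le ?_ ?_
  · refine hSpan_le_ker_evalTree ?_
    rintro _ ⟨m, T, hT, rfl⟩
    rw [evalTree_tree]
    refine graphPoly_eq_zero_of_hasNakedChain hr hT (by rw [hhess, hnil])
      -- Euler's identity for the cubic `H j`: its gradient paired with `X / 3` returns `H j`.
      (fun b => C (algebraMap ℚ K (1 / 3)) * X b) fun j => ?_
    simp only [mul_assoc]
    rw [← Finset.mul_sum, hhess, hP]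
    change _ = _ * ∑ b, X b * pderiv b (H j)
    rw [(hH j).sum_X_mul_pderiv, nsmul_eq_mul, ← map_natCast (C (σ := Fin n)),
        ← mul_assoc, ← C_mul, ← map_natCast (algebraMap ℚ K), ← map_mul]
    norm_num
  · refine Submodule.span_le.2 ?_
    rintro _ ⟨m, T, ⟨v, hv⟩, rfl⟩
    change evalTree P (tree T) = 0
    rw [evalTree_tree]
    refine graphPoly_eq_zero_of_degree (v := v) (d := 4) ?_ hP4
    refine Nat.lt_of_succ_le (hv.trans_eq ?_)
    congr!

theorem treeN_eq_zero_of_nuBar {r : ℕ} (hr : 0 < r) {H : PolyMap n K}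
    (hH : ∀ i, (H i).IsHomogeneous 3) (hnil : jacobian H ^ r = 0) {P : MvPolynomial (Fin n) K}
    (hP4 : P.IsHomogeneous 4) (hP : ∀ j, pderiv j P = H j) {m : ℕ} (hm : nuBar r 4 m = 0)
    (i : Fin n) : treeN H m i = 0 := by
  have h1 : nu m ∈ relSub r 4 := by
    rwa [nuBar, Submodule.mkQ_apply, Submodule.Quotient.mk_eq_zero] at hm
  have h2 : evalTree P (nu m) = 0 := relSub_le_ker_evalTree hr hH hnil hP4 hP h1
  rw [evalTree_nu] at h2
  rw [treeN_eq m hP, ← map_rat_smul (pderiv (R := K) i), h2, map_zero]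

end Relations

theorem cubicSymmInversion_of_nuBar {r : ℕ} (hr : 0 < r) {M : ℕ} (hM : 0 < M)
    (h : ∀ m, M + 1 ≤ m → m ≤ 2 * M → nuBar r 4 m = 0) : CubicSymmInversion.{u} r M := by
  intro K _ _ n F H hF hnil
  obtain ⟨-, hFH, hH, hs⟩ := hF
  obtain ⟨P, hP4, hP⟩ := exists_potential hH hs
  have hgap := treeN_eq_zero_of_gap hP hM fun m h1 h2 i =>
    treeN_eq_zero_of_nuBar hr hH hnil hP4 hP (h m h1 h2) i
  refine ⟨isInverse_of_burgers hFH (N := treeN H) (treeN_zero hP) (treeN_one hP) hgap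
    (nsmul_treeN hP), fun i => ?_⟩
  refine (totalDegree_add _ _).trans (max_le ?_ ?_)
  · exact (isHomogeneous_X K i).totalDegree_le.trans (by omega)
  · refine totalDegree_finsetSum_le fun m hm => ?_
    refine (treeN_isHomogeneous hP hH m i).totalDegree_le.trans ?_
    have := (Finset.mem_Icc.1 hm).2
    omega

theorem nuBar_mem_quotPiece (r e m : ℕ) : nuBar r e m ∈ quotPiece r e m := by
  refine Submodule.mem_map_of_mem (Submodule.sum_mem _ fun T _ => Submodule.smul_mem _ _ ?_)
  exact Submodule.subset_span ⟨T, rfl⟩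

/-! ### The grading of the tree quotient modules -/

/-- The projection of `𝓜` to the span of the trees with `m` vertices. -/
noncomputable def gradedProj (m : ℕ) : TreeMod →ₗ[ℚ] TreeMod :=
  Finsupp.linearCombination ℚ fun T : Σ m, FreeTree m =>
    if T.1 = m then Finsupp.single T 1 else 0

theorem gradedProj_single (m : ℕ) (T : Σ m, FreeTree m) (c : ℚ) :
    gradedProj m (Finsupp.single T c) = if T.1 = m then Finsupp.single T c else 0 := by
  rw [gradedProj, Finsupp.linearCombination_single]
  split_ifs <;> simp

/-- Grafting discards the root of `S`, so the action raises the degree by `S.1 - 1`. -/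
theorem gradedProj_act_single (S : Σ k, RootedTree k) (m : ℕ) (x : TreeMod) :
    gradedProj m (act (Finsupp.single S 1) x)
      = if S.1 - 1 ≤ m then act (Finsupp.single S 1) (gradedProj (m - (S.1 - 1)) x) else 0 := by
  classical
  induction x using Finsupp.induction_linear with
  | zero => simp
  | add x y hx hy =>
    rw [map_add, map_add, hx, hy]
    split_ifs
    · rw [map_add, map_add]
    · rw [add_zero]
  | single T c =>
    have hcard : ∀ f : {c : Fin S.1 // S.2.graph.Adj S.2.root c} → Fin T.1, (FreeTree.ofGraph (graft S.2.graph S.2.root T.2.graph f)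
            (graft_isTree S.2.isTree T.2.isTree f)).1 = (S.1 - 1) + T.1 := by
      intro f
      change Fintype.card ({u : Fin S.1 // u ≠ S.2.root} ⊕ Fin T.1) = _
      rw [← Nat.card_eq_fintype_card, Nat.card_sum, Nat.card_eq_fintype_card,
        Nat.card_eq_fintype_card, Fintype.card_subtype_compl, Fintype.card_subtype_eq,
        Fintype.card_fin, Fintype.card_fin]
    have hact : act (Finsupp.single S 1) (Finsupp.single T c) = c •
        ∑ f : {c : Fin S.1 // S.2.graph.Adj S.2.root c} → Fin T.1,
        Finsupp.single
          (FreeTree.ofGraph (graft S.2.graph S.2.root T.2.graph f)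
            (graft_isTree S.2.isTree T.2.isTree f)) (1 : ℚ) := by
      simp only [act, Finsupp.linearCombination_single, one_smul]
    rw [gradedProj_single, hact, map_smul, map_sum]
    simp only [gradedProj_single, hcard]
    by_cases h : S.1 - 1 ≤ m
    · rw [if_pos h]
      by_cases h2 : T.1 = m - (S.1 - 1)
      · rw [if_pos h2, hact]
        have : S.1 - 1 + T.1 = m := by omega
        simp only [this, if_true]
      · rw [if_neg h2, map_zero]
        have : ¬ S.1 - 1 + T.1 = m := by omega
        simp only [this, if_false, Finset.sum_const_zero, smul_zero]
    · rw [if_neg h]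
      have : ¬ S.1 - 1 + T.1 = m := by omega
      simp only [this, if_false, Finset.sum_const_zero, smul_zero]

theorem subset_hSpan (A : Set TreeMod) : A ⊆ hSpan A := by
  intro x hx
  rw [hSpan, SetLike.mem_coe, Submodule.mem_sInf]
  exact fun W hW => hW.1 hx

theorem act_mem_hSpan {A : Set TreeMod} (h : RootedMod) {x : TreeMod} (hx : x ∈ hSpan A) :
    act h x ∈ hSpan A := by
  rw [hSpan, Submodule.mem_sInf] at hx ⊢
  exact fun W hW => hW.2 h x (hx W hW)

theorem gradedProj_tree_mem {W : Submodule ℚ TreeMod} {k : ℕ} {T : FreeTree k} (hT : tree T ∈ W)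
    (m : ℕ) : gradedProj m (tree T) ∈ W := by
  rw [tree, gradedProj_single]
  split_ifs
  · exact hT
  · exact W.zero_mem

theorem gradedProj_mem_chainSub {r : ℕ} {x : TreeMod} (hx : x ∈ chainSub r) (m : ℕ) :
    gradedProj m x ∈ chainSub r := by
  -- All degrees are treated together: the action shifts degree, so only the intersection over `m`
  -- is visibly stable.
  have h : chainSub r ≤ ⨅ m, (chainSub r).comap (gradedProj m) := by
    refine sInf_le ⟨?_, ?_⟩
    · intro x hx
      rw [SetLike.mem_coe, Submodule.mem_iInf]
      intro m
      have hx' : x ∈ chainSub r := subset_hSpan _ hx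
      obtain ⟨k, T, -, rfl⟩ := hx
      exact gradedProj_tree_mem hx' m
    · intro h x hx
      rw [Submodule.mem_iInf] at hx ⊢
      intro m
      rw [Submodule.mem_comap]
      induction h using Finsupp.induction_linear with
      | zero => simp
      | add h h' ih ih' =>
        rw [map_add, LinearMap.add_apply, map_add]
        exact Submodule.add_mem _ ih ih'
      | single S c =>
        rw [← mul_one c, ← smul_eq_mul, ← Finsupp.smul_single, map_smul, LinearMap.smul_apply,
          map_smul, gradedProj_act_single]
        refine Submodule.smul_mem _ _ ?_
        split_ifs
        · exact act_mem_hSpan _ (hx _)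
        · exact Submodule.zero_mem _
  have h2 := h hx
  rw [Submodule.mem_iInf] at h2
  exact h2 m

theorem gradedProj_mem_degreeSub {e : ℕ} {x : TreeMod} (hx : x ∈ degreeSub e) (m : ℕ) :
    gradedProj m x ∈ degreeSub e := by
  have h : degreeSub e ≤ (degreeSub e).comap (gradedProj m) := by
    refine Submodule.span_le.2 ?_
    intro x hx
    have hx' : x ∈ degreeSub e := Submodule.subset_span hx
    obtain ⟨k, T, -, rfl⟩ := hx
    exact gradedProj_tree_mem hx' m
  exact h hx

theorem relSub_le_comap_gradedProj (r e m : ℕ) :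
    relSub r e ≤ (relSub r e).comap (gradedProj m) := by
  refine sup_le ?_ ?_
  · exact fun x hx => Submodule.mem_sup_left (gradedProj_mem_chainSub hx m)
  · exact fun x hx => Submodule.mem_sup_right (gradedProj_mem_degreeSub hx m)

theorem gradedProj_eq_self {m : ℕ} {x : TreeMod} (hx : x ∈ gradedPiece m) :
    gradedProj m x = x := by
  have h : gradedPiece m ≤ LinearMap.eqLocus (gradedProj m) LinearMap.id := by
    refine Submodule.span_le.2 ?_
    rintro _ ⟨T, rfl⟩
    change gradedProj m (tree T) = tree T
    rw [tree, gradedProj_single, if_pos rfl]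
  exact h hx

theorem gradedProj_eventually_zero (x : TreeMod) : ∃ B, ∀ m, B < m → gradedProj m x = 0 := by
  induction x using Finsupp.induction_linear with
  | zero => exact ⟨0, by simp⟩
  | add x y hx hy =>
    obtain ⟨B, hB⟩ := hx
    obtain ⟨B', hB'⟩ := hy
    refine ⟨max B B', fun m hm => ?_⟩
    rw [map_add, hB m (lt_of_le_of_lt (le_max_left _ _) hm),
      hB' m (lt_of_le_of_lt (le_max_right _ _) hm), add_zero]
  | single T c =>
    refine ⟨T.1, fun m hm => ?_⟩
    rw [gradedProj_single, if_neg hm.ne]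

/-- A finite-dimensional tree quotient module vanishes in large degrees. -/
theorem exists_quotPiece_eq_bot (r e : ℕ) [Module.Finite ℚ (TreeQuot r e)] :
    ∃ B, ∀ m, B < m → quotPiece r e m = ⊥ := by
  classical
  obtain ⟨s, hs⟩ := Module.Finite.fg_top (R := ℚ) (M := TreeQuot r e)
  choose lift hlift using Submodule.mkQ_surjective (relSub r e)
  choose bound hbound using gradedProj_eventually_zero
  refine ⟨s.sup fun y => bound (lift y), fun m hm => ?_⟩
  set π := (relSub r e).mapQ (relSub r e) (gradedProj m) (relSub_le_comap_gradedProj r e m) with hπ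
  -- Degree `m` exceeds all degrees occurring in the lifts of the finitely many generators; yet `π`
  -- is the identity on the `m`-th piece.
  have hπ0 : π = 0 := by
    refine LinearMap.ext_on (s := (s : Set (TreeQuot r e))) hs ?_
    intro y hy
    rw [← hlift y, LinearMap.zero_apply, hπ, Submodule.mkQ_apply, Submodule.mapQ_apply, hbound,
      Submodule.Quotient.mk_zero]
    exact lt_of_le_of_lt (Finset.le_sup (f := fun y => bound (lift y)) hy) hm
  rw [eq_bot_iff]
  rintro _ ⟨x, hx, rfl⟩
  have h1 : π ((relSub r e).mkQ x) = (relSub r e).mkQ x := by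
    rw [hπ, Submodule.mkQ_apply, Submodule.mapQ_apply, gradedProj_eq_self hx]
  rw [hπ0, LinearMap.zero_apply] at h1
  exact h1.symm

end

end TreeModule

theorem theorem3p17 (r : ℕ) (hr : 0 < r) :
    (∀ M : ℕ, 0 < M →
      (∀ m, M + 1 ≤ m → m ≤ 2 * M → TreeModule.nuBar r 4 m = 0) →
        TreeModule.CubicSymmInversion.{u} r M) ∧
    (∀ M : ℕ, 0 < M →
      (∀ m, M + 1 ≤ m → m ≤ 2 * M → TreeModule.quotPiece r 4 m = ⊥) →
        TreeModule.CubicSymmInversion.{u} r M) ∧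
    (Module.Finite ℚ (TreeModule.TreeQuot r 4) →
      ∃ M : ℕ, 0 < M ∧ (∀ m, M + 1 ≤ m → TreeModule.quotPiece r 4 m = ⊥) ∧
        TreeModule.CubicSymmInversion.{u} r M) := by
  have key : ∀ M : ℕ, 0 < M →
      (∀ m, M + 1 ≤ m → m ≤ 2 * M → TreeModule.quotPiece r 4 m = ⊥) →
        TreeModule.CubicSymmInversion.{u} r M := fun M hM h =>
    TreeModule.cubicSymmInversion_of_nuBar hr hM fun m h1 h2 => by
      have h3 := TreeModule.nuBar_mem_quotPiece r 4 m
      rwa [h m h1 h2, Submodule.mem_bot] at h3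
  refine ⟨fun M hM h => TreeModule.cubicSymmInversion_of_nuBar hr hM h, key, fun hfin => ?_⟩
  obtain ⟨B, hB⟩ := TreeModule.exists_quotPiece_eq_bot r 4
  -- The maximum with 1 only ensures that `M` is positive.
  have hbot : ∀ m, max B 1 + 1 ≤ m → TreeModule.quotPiece r 4 m = ⊥ := fun m hm =>
    hB m (lt_of_le_of_lt (le_max_left _ _) hm)
  have hpos : 0 < max B 1 := lt_max_of_lt_right one_pos
  exact ⟨max B 1, hpos, hbot, key _ hpos fun m h1 _ => hbot m h1⟩
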